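/- Let $G$ be a connected complex reductive group with maximal torus $H$ and Borel subgroup $P_0\supset H$, and let $\Delta_0$ be the set of simple roots, $\pi_1(H)$ the cocharacter lattice and $\mathfrak a_0=\mathbb R\otimes\pi_1(H)$. (Everything below depends only on the based root datum of $G$.) Let $\mathscr P$ be the set of standard parabolic subgroups. For $P\in\mathscr P$ let $M_P$ be its Levi subgroup containing $H$, $\Delta_0^P\subset\Delta_0$ the set of simple roots of $M_P$, $\mathfrak a_0^P\subset\mathfrak a_0$ the span of the coroots $\alpha^\vee$, $\alpha\in\Delta_0^P$, and $\mathfrak a_P=\bigcap_{\alpha\in\Delta_0^P}\ker\alpha$. Then $\mathfrak a_0=\mathfrak a_0^P\oplus\mathfrak a_P$; let $[\cdot]_P$ be the projection onto $\mathfrak a_P$ and $[\cdot]^P=1-[\cdot]_P$. For $P\subset Q$ put $\mathfrak a_P^Q=\mathfrak a_P\cap\mathfrak a_0^Q$, let $\Delta_P^Q$ be the set of restrictions $\alpha=\tilde\alpha|_{\mathfrak a_P^Q}$ of the $\tilde\alpha\in\Delta_0^Q\setminus\Delta_0^P$, and put $\alpha^\vee=[\tilde\alpha^\vee]_P\in\mathfrak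 a_P^Q$. For $\tilde\alpha\in\Delta_0^Q$ let $\varpi^Q_{\tilde\alpha}$ be the fundamental weight of $M_Q$: the linear form on $\mathfrak a_0$ that vanishes on $\mathfrak a_Q$ and satisfies $\varpi^Q_{\tilde\alpha}(\tilde\beta^\vee)=\delta_{\tilde\alpha\tilde\beta}$ for $\tilde\beta\in\Delta_0^Q$. Let $\Lambda_{P_0}^P=\pi_1(H)/\bigoplus_{\alpha\in\Delta_0^P}\mathbb Z\alpha^\vee=\pi_1(M_P)$ and $\mathfrak T=\{(P,\nu_P): P\in\mathscr P,\ \nu_P\in\Lambda_{P_0}^P\}$. For $P\subset Q$ let $\nu_P\mapsto[\nu_P]_Q$ be the quotient map $\Lambda_{P_0}^P\to\Lambda_{P_0}^Q$, and let $\nu_P'\in\mathfrak a_P$ be the slope of $\nu_P$, i.e. $[y]_P$ for any representative $y\in\pi_1(H)$ of $\nu_P$. For $\tilde\alpha\in\Delta_0^Q$ let $\varpi^Q_{\tilde\alpha}(\nu_Q)\in\mathbb R/\mathbb Z$ be the class of $\varpi^Q_{\tilde\alpha}(y)$ for any representative $y$ of $\nu_Q$. For $\mu\in\mathbb R/\mathbb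 Z$ let $\langle\mu\rangle$ be its representative in $(0,1]$. Let $\tau_P^Q$ and $\widehat\tau_P^Q$ be the characteristic functions of the conditions $\langle\alpha,\cdot\rangle>0$ for all $\alpha\in\Delta_P^Q$, respectively $\langle\varpi^Q_{\tilde\alpha},\cdot\rangle>0$ for all $\tilde\alpha\in\Delta_0^Q\setminus\Delta_0^P$, and let $$\Gamma_P^Q(H,T)=\sum_{P\subset R\subset Q}(-1)^{\dim\mathfrak a_R^Q}\,\tau_P^R([H]^R)\,\widehat\tau_R^Q([H]_R-[T]_R)\qquad(H,T\in\mathfrak a_P^Q).$$ For $f$ with values in a topological abelian group, $\sum_{[\nu_P]_Q=\nu_Q}\tau_P^Q([\nu_P']^Q)f(\nu_P)$ denotes the limit of the finite sums $\sum_{[\nu_P]_Q=\nu_Q}\Gamma_P^Q([\nu_P']^Q,T)f(\nu_P)$ as $T\in\mathfrak a_P^{Q+}=\{T\in\mathfrak a_P^Q:\langle\alpha,T\rangle>0\ \forall\alpha\in\Delta_P^Q\}$ goes to infinity, i.e. $\langle\alpha,T\rangle\to+\infty$ for all $\alpha\in\Delta_P^Q$. For each $P\in\mathscr P$ let $n_P\in\mathbb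 Z_{\ge0}$ and let $\varepsilon_0^P$ be a linear form on $\mathfrak a_0$ vanishing on $\mathfrak a_P$, such that for all $P\subset Q$ $$n_P\ge n_Q,\qquad(\varepsilon_0^Q-\varepsilon_0^P)|_{\mathfrak a_0^P}=0,\qquad\langle\varepsilon_P^Q,\alpha^\vee\rangle\in\mathbb Z_{>0}\ \ \forall\alpha\in\Delta_P^Q,$$ where $\varepsilon_P^Q=\varepsilon_0^Q-\varepsilon_0^P$. Put $m(P,\nu_P')=n_P+\langle\varepsilon_P^G,\nu_P'\rangle$, and assume that $m(P,\nu_P')-m(Q,\nu_Q')\in2\mathbb Z$ whenever $P\subset Q$, $\nu_P\in\Lambda^P_{P_0}$ and $\nu_Q=[\nu_P]_Q$. (Then all exponents of $uv$ that occur below with a nonzero coefficient are nonnegative integers.) Let $A$ be a $\mathbb Z[\![u,v]\!]$-module that is complete and separated for the $(u,v)$-adic topology, and let $a_0:\mathscr P\to A$ be any function. Then there is a unique function $b_0:\mathfrak T\to A$ such that for every $(Q,\nu_Q)\in\mathfrak T$ the following limits exist and $$a_0(Q)=\sum_{P\in\mathscr P,\,P\subset Q}\ \sum_{[\nu_P]_Q=\nu_Q}\tau_P^Q([\nu_P']^Q)\,b_0(P,\nu_P)\,(uv)^{\frac12(m(P,\nu_P')-m(Q,\nu_Q'))}.$$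 It is given, for every $(Q,\nu_Q)\in\mathfrak T$, by $$b_0(Q,\nu_Q)=\sum_{P\in\mathscr P,\,P\subset Q}(-1)^{\dim\mathfrak a_P^Q}\,a_0(P)\,(uv)^{\frac12(n_P-n_Q)}\Bigl(\prod_{\alpha\in\Delta_P^Q}\frac1{1-(uv)^{\frac12\langle\varepsilon_P^Q,\alpha^\vee\rangle}}\Bigr)(uv)^{\frac12\sum_{\alpha\in\Delta_P^Q}\langle\varepsilon_P^Q,\alpha^\vee\rangle\langle\varpi^Q_{\tilde\alpha}(\nu_Q)\rangle}.$$ -/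

import Mathlib

/-! A connected complex reductive group `G` with a maximal torus `H` and a Borel subgroup `B ⊇ H` is
given by its root datum `D` (`X` is the character lattice of `H`, `Y` is the cocharacter
lattice `π₁(H)`) and the base `b` of simple roots `Δ₀` that `B` determines. Everything below depends
on these data only. -/

open scoped TensorProduct

namespace ReductiveInversion

noncomputable section

section RootDatum

variable {ι X Y : Type*} [AddCommGroup X] [AddCommGroup Y] {D : RootDatum ι X Y}

/-- The standard parabolic subgroups `P`. Such a `P` is encoded by the set `Δ₀ᴾ ⊆ Δ₀` of the simple
roots of its Levi subgroup, so that `P ⊆ Q` is inclusion of finsets, the Borel subgroup is `∅` and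
`G` is `Finset.univ`. -/
abbrev Parabolic (b : D.Base) : Type _ := Finset b.support

/-- The real vector space `𝔞₀ = ℝ ⊗ π₁(H)`. -/
abbrev A0 (Y : Type*) [AddCommGroup Y] : Type _ := ℝ ⊗[ℤ] Y

/-- A simple root, as a linear form on `𝔞₀`. -/
def rootForm (b : D.Base) (α : b.support) : Module.Dual ℝ (A0 Y) :=
  LinearMap.liftBaseChange ℝ ((Algebra.linearMap ℤ ℝ) ∘ₗ D.root' α)

/-- A simple coroot, as a vector of `𝔞₀`. -/
def corootVec (b : D.Base) (α : b.support) : A0 Y := 1 ⊗ₜ[ℤ] D.coroot α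

/-- `𝔞₀ᴾ`, the span of the simple coroots of the Levi subgroup of `P`. -/
def derivedSpace (b : D.Base) (P : Parabolic b) : Submodule ℝ (A0 Y) :=
  Submodule.span ℝ (Set.range fun α : P => corootVec b α)

/-- `𝔞_P`, the Lie algebra of the (split) center of the Levi subgroup of `P`. -/
def centerSpace (b : D.Base) (P : Parabolic b) : Submodule ℝ (A0 Y) :=
  ⨅ α ∈ P, LinearMap.ker (rootForm b α)

/-- `𝔞_P^Q = 𝔞_P ∩ 𝔞₀^Q`. -/
def relSpace (b : D.Base) (P Q : Parabolic b) : Submodule ℝ (A0 Y) :=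
  centerSpace b P ⊓ derivedSpace b Q

/-- The coroot lattice of the Levi subgroup of `P`. -/
def corootLattice (b : D.Base) (P : Parabolic b) : Submodule ℤ Y :=
  Submodule.span ℤ (Set.range fun α : P => D.coroot α)

/-- `Λ_{P₀}^P = π₁(M_P)`, the topological types of `M_P`-bundles. -/
abbrev TopType (b : D.Base) (P : Parabolic b) : Type _ := Y ⧸ corootLattice b P

theorem corootLattice_mono (b : D.Base) {P Q : Parabolic b} (h : P ⊆ Q) :
    corootLattice b P ≤ corootLattice b Q := by
  refine Submodule.span_mono ?_
  rintro _ ⟨α, rfl⟩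
  exact ⟨⟨α, h α.2⟩, rfl⟩

/-- `ν_P ↦ [ν_P]_Q`, for `P ⊆ Q`. -/
def pushType (b : D.Base) {P Q : Parabolic b} (h : P ⊆ Q) : TopType b P →ₗ[ℤ] TopType b Q :=
  Submodule.factor (corootLattice_mono b h)

theorem linearIndependent_corootVec (b : D.Base) (P : Parabolic b) :
    LinearIndependent ℝ (fun α : P => corootVec b α) := by
  have h : LinearIndependent ℤ (fun α : b.support => D.coroot α) := b.linearIndepOn_coroot
  exact (Module.Flat.linearIndependent_one_tmul (S := ℝ) h).comp (fun α : P => (α : b.support))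
    Subtype.val_injective

theorem mem_centerSpace {b : D.Base} {P : Parabolic b} {x : A0 Y} :
    x ∈ centerSpace b P ↔ ∀ α ∈ P, rootForm b α x = 0 := by
  simp [centerSpace]

theorem disjoint_derivedSpace_centerSpace [Finite ι] (b : D.Base) (P : Parabolic b) :
    Disjoint (derivedSpace b P) (centerSpace b P) := by
  cases nonempty_fintype ι
  rw [Submodule.disjoint_def]
  intro x hx hx'
  rw [mem_centerSpace] at hx'
  let r : ι → Module.Dual ℝ (A0 Y) := fun i =>
    LinearMap.liftBaseChange ℝ ((Algebra.linearMap ℤ ℝ) ∘ₗ D.root' i)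
  have hr : ∀ (i : ι) (s : ℝ) (y : Y), r i (s ⊗ₜ y) = s * (D.root' i y : ℝ) := by
    intro i s y; simp [r]
  let N : b.support → ℤ := fun β => D.CorootForm (D.coroot β) (D.coroot β)
  have hN : ∀ β, 0 < N β := by
    intro β
    simp only [N, RootPairing.corootForm_apply_apply]
    refine Finset.sum_pos' (fun i _ => mul_self_nonneg _) ⟨β, Finset.mem_univ _, ?_⟩
    simp
  have key : ∀ (β : b.support) (y : A0 Y),
      (N β : ℝ) * rootForm b β y = 2 * ∑ i, (D.root' i (D.coroot β) : ℝ) * r i y := by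
    intro β y
    induction y using TensorProduct.induction_on with
    | zero => simp
    | add a c ha hc =>
      simp only [map_add, mul_add, Finset.sum_add_distrib, ha, hc]
    | tmul s y =>
      have h := congrArg (fun z => D.toLinearMap z y) (D.corootForm_self_smul_root (β : ι))
      rw [RootPairing.CoPolarization_apply] at h
      simp only [map_smul, LinearMap.smul_apply, map_sum, map_nsmul,
        LinearMap.sum_apply, smul_eq_mul] at h
      rw [nsmul_eq_mul] at h
      have h' : (N β : ℝ) * (D.root' β y : ℝ)
          = 2 * ∑ i, (D.root' i (D.coroot β) : ℝ) * (D.root' i y : ℝ) := by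
        exact_mod_cast h
      change (N β : ℝ) * r β (s ⊗ₜ y) = _
      simp only [hr]
      rw [mul_left_comm, h', mul_left_comm, Finset.mul_sum]
      congr 1
      exact Finset.sum_congr rfl fun i _ => by ring
  obtain ⟨c, rfl⟩ := (Submodule.mem_span_range_iff_exists_fun ℝ).1 hx
  set x : A0 Y := ∑ β, c β • corootVec b β with hxdef
  have hrx : ∀ i, r i x = ∑ β, c β * (D.root' i (D.coroot β) : ℝ) := by
    intro i
    simp [hxdef, corootVec, hr]
  have hsq : ∑ i, r i x * r i x = 0 := by
    have h1 : ∀ β : P, ∑ i, (D.root' i (D.coroot β) : ℝ) * r i x = 0 := by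
      intro β
      have := key β x
      rw [hx' β β.2] at this
      linarith
    calc ∑ i, r i x * r i x = ∑ i, ∑ β, c β * ((D.root' i (D.coroot β) : ℝ) * r i x) := by
          refine Finset.sum_congr rfl fun i _ => ?_
          conv_lhs => rw [hrx i, Finset.sum_mul]
          refine Finset.sum_congr rfl fun β _ => ?_
          rw [← hrx i]; ring
      _ = ∑ β, c β * ∑ i, (D.root' i (D.coroot β) : ℝ) * r i x := by
          rw [Finset.sum_comm]
          exact Finset.sum_congr rfl fun β _ => by rw [Finset.mul_sum]
      _ = 0 := Finset.sum_eq_zero fun β _ => by rw [h1, mul_zero]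
  have hzero : ∀ i, r i x = 0 := by
    intro i
    have := (Finset.sum_eq_zero_iff_of_nonneg (fun i _ => mul_self_nonneg (r i x))).1 hsq i
      (Finset.mem_univ _)
    simpa using this
  have hroot : LinearIndependent ℝ (fun β : P => (1 : ℝ) ⊗ₜ[ℤ] D.root β) := by
    have h : LinearIndependent ℤ (fun α : b.support => D.root α) := b.linearIndepOn_root
    exact (Module.Flat.linearIndependent_one_tmul (S := ℝ) h).comp (fun α : P => (α : b.support))
      Subtype.val_injective
  have hcomb : ∑ β : P, (c β * N β) • ((1 : ℝ) ⊗ₜ[ℤ] D.root β) = 0 := by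
    have h1 : ∀ β : P, (N β : ℝ) • ((1 : ℝ) ⊗ₜ[ℤ] D.root β)
        = (2 : ℝ) • ∑ i, (D.root' i (D.coroot β) : ℝ) • ((1 : ℝ) ⊗ₜ[ℤ] D.root i) := by
      intro β
      have h := congrArg (fun z => (1 : ℝ) ⊗ₜ[ℤ] z) (D.corootForm_self_smul_root (β : ι))
      simp only [RootPairing.CoPolarization_apply, TensorProduct.tmul_smul,
        TensorProduct.tmul_sum] at h
      simpa [N, Int.cast_smul_eq_zsmul, two_smul] using h
    calc ∑ β : P, (c β * N β) • ((1 : ℝ) ⊗ₜ[ℤ] D.root β)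
        = ∑ β : P, ∑ i, (2 * (c β * (D.root' i (D.coroot β) : ℝ))) • ((1 : ℝ) ⊗ₜ[ℤ] D.root i) := by
          refine Finset.sum_congr rfl fun β _ => ?_
          rw [mul_smul, h1, smul_smul, Finset.smul_sum]
          refine Finset.sum_congr rfl fun i _ => ?_
          rw [smul_smul]; congr 1; ring
      _ = ∑ i, (2 * r i x) • ((1 : ℝ) ⊗ₜ[ℤ] D.root i) := by
          rw [Finset.sum_comm]
          refine Finset.sum_congr rfl fun i _ => ?_
          rw [hrx i, ← Finset.sum_smul, Finset.mul_sum]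
      _ = 0 := by simp [hzero]
  have hc : ∀ β : P, c β = 0 := by
    intro β
    have := Fintype.linearIndependent_iff.1 hroot _ hcomb β
    have hpos : (N β : ℝ) ≠ 0 := by exact_mod_cast (hN β).ne'
    exact (mul_eq_zero.1 this).resolve_right hpos
  rw [hxdef]
  simp [hc]

variable [Finite ι]

/-- `𝔞₀ = 𝔞₀ᴾ ⊕ 𝔞_P`. -/
theorem isCompl_derivedSpace_centerSpace (b : D.Base) (P : Parabolic b) :
    IsCompl (derivedSpace b P) (centerSpace b P) := by
  refine ⟨disjoint_derivedSpace_centerSpace b P, ?_⟩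
  let f : A0 Y →ₗ[ℝ] (P → ℝ) := LinearMap.pi fun α => rootForm b α
  let g : derivedSpace b P →ₗ[ℝ] (P → ℝ) := f ∘ₗ (derivedSpace b P).subtype
  have : FiniteDimensional ℝ (derivedSpace b P) :=
    FiniteDimensional.span_of_finite ℝ (Set.finite_range _)
  have hg : Function.Injective g := by
    rw [← LinearMap.ker_eq_bot, LinearMap.ker_eq_bot']
    intro x hx
    have hx' : (x : A0 Y) ∈ centerSpace b P :=
      mem_centerSpace.2 fun α hα => congrFun hx ⟨α, hα⟩
    exact Subtype.ext ((Submodule.disjoint_def.1 (disjoint_derivedSpace_centerSpace b P)) x x.2 hx')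
  have hdim : Module.finrank ℝ (derivedSpace b P) = Module.finrank ℝ (P → ℝ) := by
    rw [derivedSpace, finrank_span_eq_card (linearIndependent_corootVec b P)]
    simp
  have hsurj : Function.Surjective g := (LinearMap.injective_iff_surjective_of_finrank_eq_finrank hdim).1 hg
  rw [codisjoint_iff, eq_top_iff]
  intro y _
  obtain ⟨x, hx⟩ := hsurj (f y)
  refine Submodule.mem_sup.2 ⟨x, x.2, y - x, mem_centerSpace.2 fun α hα => ?_, by abel⟩
  have := congrFun hx ⟨α, hα⟩
  change rootForm b α x = rootForm b α y at this
  rw [map_sub, this, sub_self]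

/-- The projection `[·]_P` of `𝔞₀ = 𝔞₀ᴾ ⊕ 𝔞_P` onto `𝔞_P`. -/
def proj (b : D.Base) (P : Parabolic b) : A0 Y →ₗ[ℝ] A0 Y :=
  (centerSpace b P).projection (derivedSpace b P) (isCompl_derivedSpace_centerSpace b P).symm

/-- The basis of `𝔞₀ᴾ` formed by the simple coroots. -/
def corootBasis (b : D.Base) (P : Parabolic b) : Module.Basis P ℝ (derivedSpace b P) :=
  Module.Basis.span (linearIndependent_corootVec b P)

/-- For `α ∈ Δ₀^Q`, the fundamental weight of the Levi subgroup of `Q`, as a linear form on `𝔞₀`: on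
`𝔞₀^Q` it is the coordinate along `α^∨` in the basis of simple coroots, and it is `0` on `𝔞_Q`. -/
def fundWeight (b : D.Base) (Q : Parabolic b) (α : b.support) : Module.Dual ℝ (A0 Y) :=
  open scoped Classical in
  if h : α ∈ Q then
    (corootBasis b Q).coord ⟨α, h⟩ ∘ₗ
      (derivedSpace b Q).projectionOnto (centerSpace b Q) (isCompl_derivedSpace_centerSpace b Q)
  else 0

/-- The coroot `α^∨ = [α̃^∨]_P ∈ 𝔞_P^Q` of the element `α = α̃|_{𝔞_P^Q}` of `Δ_P^Q`, for
`α̃ ∈ Δ₀^Q \ Δ₀^P`. -/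
def relCoroot (b : D.Base) (P : Parabolic b) (α : b.support) : A0 Y := proj b P (corootVec b α)

/-- `Δ_P^Q`, indexed by `Δ₀^Q \ Δ₀^P`. -/
def relSimple (b : D.Base) (P Q : Parabolic b) : Finset b.support :=
  open scoped Classical in Q \ P

/-- `τ_P^Q`, the characteristic function of the `H` with `⟨α, H⟩ > 0` for all `α ∈ Δ_P^Q`. -/
def tau (b : D.Base) (P Q : Parabolic b) (H : A0 Y) : ℤ :=
  open scoped Classical in if ∀ α ∈ relSimple b P Q, 0 < rootForm b α H then 1 else 0

/-- `τ̂_P^Q`, the characteristic function of the `H` with `⟨ϖ, H⟩ > 0` for all fundamental weights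
`ϖ` dual to the coroots of `Δ_P^Q`. -/
def tauHat (b : D.Base) (P Q : Parabolic b) (H : A0 Y) : ℤ :=
  open scoped Classical in if ∀ α ∈ relSimple b P Q, 0 < fundWeight b Q α H then 1 else 0

/-- Arthur's function
`Γ_P^Q(H, T) = ∑_{P ⊆ R ⊆ Q} (-1)^{dim 𝔞_R^Q} τ_P^R([H]^R) τ̂_R^Q([H]_R - [T]_R)` on
`𝔞_P^Q × 𝔞_P^Q`; here `[H]^R = H - [H]_R`. -/
def Gam (b : D.Base) (P Q : Parabolic b) (H T : A0 Y) : ℤ :=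
  open scoped Classical in
  ∑ R ∈ Q.powerset with P ⊆ R, (-1) ^ Module.finrank ℝ (relSpace b R Q) *
    tau b P R (H - proj b R H) * tauHat b R Q (proj b R H - proj b R T)

/-- The open chamber `𝔞_P^{Q+}`. -/
def chamber (b : D.Base) (P Q : Parabolic b) : Set (A0 Y) :=
  {T | T ∈ relSpace b P Q ∧ ∀ α ∈ relSimple b P Q, 0 < rootForm b α T}

/-- `T ∈ 𝔞_P^{Q+}` goes to infinity: `⟨α, T⟩ → +∞` for every `α ∈ Δ_P^Q`. -/
def chamberAtTop (b : D.Base) (P Q : Parabolic b) : Filter (A0 Y) :=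
  (⨅ α ∈ relSimple b P Q, Filter.comap (rootForm b α) Filter.atTop) ⊓
    Filter.principal (chamber b P Q)

/-- `𝔗`, the pairs `(P, ν_P)`. -/
abbrev TypePair (b : D.Base) : Type _ := Σ P : Parabolic b, TopType b P

theorem proj_corootVec (b : D.Base) {P : Parabolic b} (α : P) : proj b P (corootVec b α) = 0 := by
  have h : corootVec b α ∈ derivedSpace b P := Submodule.subset_span ⟨α, rfl⟩
  exact (Submodule.projection_apply_eq_zero_iff _).2 h

/-- The slope `ν_P'` of `ν_P`: its image in `X_*(A_P') = π₁(H)/Λ̂_P ⊆ 𝔞_P`. -/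
def slope (b : D.Base) (P : Parabolic b) : TopType b P →ₗ[ℤ] A0 Y :=
  (corootLattice b P).liftQ
    (((proj b P).restrictScalars ℤ) ∘ₗ TensorProduct.mk ℤ ℝ Y 1) (by
      refine Submodule.span_le.2 ?_
      rintro _ ⟨α, rfl⟩
      exact proj_corootVec b α)

/-- `[ν_P']^Q ∈ 𝔞_P^Q`. -/
def slopeRel (b : D.Base) (P Q : Parabolic b) (ν : TopType b P) : A0 Y :=
  slope b P ν - proj b Q (slope b P ν)

theorem fundWeight_corootVec (b : D.Base) (Q : Parabolic b) (α : b.support) (β : Q) :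
    ∃ k : ℤ, fundWeight b Q α (corootVec b β) = k := by
  classical
  by_cases h : α ∈ Q
  · have hβ : corootVec b β ∈ derivedSpace b Q := Submodule.subset_span ⟨β, rfl⟩
    have h1 : (derivedSpace b Q).projectionOnto (centerSpace b Q)
        (isCompl_derivedSpace_centerSpace b Q) (corootVec b β)
        = corootBasis b Q β := by
      rw [Submodule.projectionOnto_apply_left (isCompl_derivedSpace_centerSpace b Q)
        ⟨corootVec b β, hβ⟩]
      exact (Module.Basis.span_apply (linearIndependent_corootVec b Q) β).symm
    simp only [fundWeight, h, dif_pos, LinearMap.comp_apply, h1, Module.Basis.coord_apply,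
      Module.Basis.repr_self]
    refine ⟨if β = ⟨α, h⟩ then 1 else 0, ?_⟩
    rw [Finsupp.single_apply]
    split_ifs <;> simp
  · exact ⟨0, by simp [fundWeight, h]⟩

/-- `ν_Q ↦ ϖ_α(ν_Q) = ϖ_α(y) + ℤ ∈ ℝ/ℤ` for any `y ∈ π₁(H)` representing `ν_Q`, where `ϖ_α` is the
fundamental weight of the Levi subgroup of `Q`. -/
def fundWeightClass (b : D.Base) (Q : Parabolic b) (α : b.support) :
    TopType b Q →ₗ[ℤ] UnitAddCircle :=
  (corootLattice b Q).liftQ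
    ((QuotientAddGroup.mk' (AddSubgroup.zmultiples (1 : ℝ))).toIntLinearMap ∘ₗ
      ((fundWeight b Q α).restrictScalars ℤ) ∘ₗ TensorProduct.mk ℤ ℝ Y 1) (by
      refine Submodule.span_le.2 ?_
      rintro _ ⟨β, rfl⟩
      obtain ⟨k, hk⟩ := fundWeight_corootVec b Q α β
      have : ((fundWeight b Q α (corootVec b β) : ℝ) : UnitAddCircle) = 0 := by
        rw [hk]
        exact (AddCircle.coe_eq_zero_iff (1 : ℝ)).2 ⟨k, by simp⟩
      exact this)

/-- `⟨μ⟩`, the representative of `μ ∈ ℝ/ℤ` in `(0, 1]`. -/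
def posRep (μ : UnitAddCircle) : ℝ := (AddCircle.equivIoc (1 : ℝ) 0 μ : ℝ)

/-- `m(P, ν_P') = n_P + ⟨ε_P^G, ν_P'⟩`, where `ε_P^G` is `ε₀^G - ε₀^P` on `𝔞_P`. -/
def mFun (b : D.Base) (n : Parabolic b → ℕ) (ε : Parabolic b → Module.Dual ℝ (A0 Y))
    (P : Parabolic b) (ν : TopType b P) : ℝ :=
  n P + (ε Finset.univ - ε P) (slope b P ν)

end RootDatum

section Module

/-- `ℤ⟦u, v⟧`. -/
abbrev PS : Type := MvPowerSeries (Fin 2) ℤ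

/-- The ideal `(u, v)` of `ℤ⟦u, v⟧`. -/
def uvIdeal : Ideal PS := Ideal.span {MvPowerSeries.X 0, MvPowerSeries.X 1}

/-- `(uv)^x`, for a real number `x` that is a nonnegative integer. -/
def uvPow (x : ℝ) : PS := (MvPowerSeries.X 0 * MvPowerSeries.X 1) ^ ⌊x⌋₊

variable {ι X Y : Type*} [Finite ι] [AddCommGroup X] [AddCommGroup Y] {D : RootDatum ι X Y}
  {A : Type*} [AddCommGroup A] [Module PS A]

/-- `s = ∑_{[ν_P]_Q = ν_Q} τ_P^Q([ν_P']^Q) f(ν_P)`: the sums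
`∑_{[ν_P]_Q = ν_Q} Γ_P^Q([ν_P']^Q, T) f(ν_P)`, which are finite for `T ∈ 𝔞_P^{Q+}`, converge to `s`
in the `(u, v)`-adic topology of `A` as `T ∈ 𝔞_P^{Q+}` goes to infinity. -/
def HasTauSum (b : D.Base) {P Q : Parabolic b} (h : P ⊆ Q) (νQ : TopType b Q)
    (f : TopType b P → A) (s : A) : Prop :=
  Filter.Tendsto
    (fun T : A0 Y => ∑ᶠ ν : {ν : TopType b P // pushType b h ν = νQ},
      Gam b P Q (slopeRel b P Q ν) T • f ν)
    (chamberAtTop b P Q) (@nhds A (uvIdeal.adicModuleTopology A) s)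

/-- The recursion `a₀(Q) = ∑_{P ⊆ Q} ∑_{[ν_P]_Q = ν_Q}
τ_P^Q([ν_P']^Q) b₀(P, ν_P) (uv)^{(m(P, ν_P') - m(Q, ν_Q'))/2}` for all `(Q, ν_Q) ∈ 𝔗`, including the
convergence of the inner sums. -/
def SatisfiesRecursion (b : D.Base) (n : Parabolic b → ℕ)
    (ε : Parabolic b → Module.Dual ℝ (A0 Y)) (a₀ : Parabolic b → A) (b₀ : TypePair b → A) : Prop :=
  ∀ (Q : Parabolic b) (νQ : TopType b Q), ∃ s : Parabolic b → A,
    (∀ (P : Parabolic b) (h : P ⊆ Q), HasTauSum b h νQ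
      (fun ν => uvPow ((mFun b n ε P ν - mFun b n ε Q νQ) / 2) • b₀ ⟨P, ν⟩) (s P)) ∧
    a₀ Q = ∑ P ∈ Q.powerset, s P

/-- The closed formula
`∑_{P ⊆ Q} (-1)^{dim 𝔞_P^Q} a₀(P) (uv)^{(n_P - n_Q)/2} ∏_α (1 - (uv)^{⟨ε_P^Q, α^∨⟩/2})⁻¹ ⬝
(uv)^{(1/2) ∑_α ⟨ε_P^Q, α^∨⟩ ⟨ϖ_α(ν_Q)⟩}`, where `α` runs over `Δ_P^Q`. -/
def closedFormula (b : D.Base) (n : Parabolic b → ℕ)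
    (ε : Parabolic b → Module.Dual ℝ (A0 Y)) (a₀ : Parabolic b → A)
    (Q : Parabolic b) (νQ : TopType b Q) : A :=
  ∑ P ∈ Q.powerset, (-1 : ℤ) ^ Module.finrank ℝ (relSpace b P Q) •
    ((uvPow (((n P : ℝ) - n Q) / 2) *
      (∏ α ∈ relSimple b P Q, Ring.inverse (1 - uvPow ((ε Q - ε P) (relCoroot b P α) / 2))) *
      uvPow ((∑ α ∈ relSimple b P Q,
        (ε Q - ε P) (relCoroot b P α) * posRep (fundWeightClass b Q α νQ)) / 2)) • a₀ P)

end Module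

end

end ReductiveInversion

/-!
*Uniqueness.* In the recursion at `(Q, ν_Q)` the summand `P = Q` is `b₀(Q, ν_Q)` itself
(`HasTauSum.eq_of_refl`), and the others only involve `P ⊊ Q`. Limits are unique because the adic
topology is Hausdorff and the chamber does reach infinity, so `b₀` is determined by induction on `Q`
(`SatisfiesRecursion.unique`). It remains to see that the closed formula is a solution
(`satisfiesRecursion_closedFormula`).

*Truncation.* Since `⟨α, [H]^R⟩ = ⟨α, H⟩` for `α ∈ Δ₀^R` and `ϖ_α^Q([H]_R) = ϖ_α^Q(H)` for
`α ∉ Δ₀^R`, the alternating sum that defines `Γ_P^Q(H, T)` factors as the product over `α ∈ Δ_P^Q`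
of `1[⟨α, H⟩ > 0] - 1[ϖ_α(H - T) > 0]` (`Gam_eq_prod`). If some weight is positive on a vector
of `𝔞_P^Q`, then for some `α` both `ϖ_α` and `α` are positive on it (`fundWeight_nonpos`, from
positive definiteness and the obtuseness of the coroots). Hence, for `T` in the chamber,
`Γ_P^Q(·, T)` is the characteristic function of `{⟨α, H⟩ > 0, ϖ_α(H) ≤ ϖ_α(T)}`
(`Gam_of_mem_chamber`), and unconditional sums over the chamber are limits of the truncated sums
(`hasTauSum_of_hasSum`).

*Langlands' combinatorial lemma.* The same product formula with `T = 0` shows that the matrices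
`τ_P^Q` and `(-1)^{dim 𝔞_P^Q} τ̂_P^Q` (evaluated at a fixed vector and indexed by pairs `P ⊆ Q`)
have product `1` in one order; a one-sided inverse of a square matrix is two-sided, which gives the
product in the other order (`langlands_tauHat_tau`).

*The closed formula.* A type `ν_P` over `ν_Q` is the same thing as a vector of coordinates
`ϖ_α(ν_P')`, `α ∈ Δ_P^Q`, in the classes `ϖ_α(ν_Q) ∈ ℝ/ℤ`. The positive elements of such a class are
`⟨ϖ_α(ν_Q)⟩ + k` with `k ≥ 0`, and `ε_P^Q = ∑ ⟨ε_P^Q, α^∨⟩ ϖ_α`. So expanding the geometric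
series in the closed formula turns it into an alternating sum, over the `ν_P` above `ν_Q` with
`τ̂_P^Q(ν_P') = 1`, of `(uv)^{(m(P, ν_P') - m(Q, ν_Q'))/2} a₀(P)` (`hasSum_closedCoeff`). The
exponents are additive in chains `P ⊆ Q ⊆ R`, so substituting into the recursion and rearranging
leaves, for each `ν_P`, the coefficient `∑_Q (-1)^{dim 𝔞_P^Q} τ̂_P^Q τ_Q^R = δ_{P,R}`
(`sum_middleInd`). All the rearranged families tend to zero adically, because on the cones in
question the exponents bound the coordinates, which leaves finitely many lattice points (`finite_middleInd`).
-/

namespace ReductiveInversion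

open scoped Classical

/-! ### Roots, weights and cones in `𝔞₀` -/

section Geometry

variable {ι X Y : Type*} [AddCommGroup X] [AddCommGroup Y] {D : RootDatum ι X Y}

theorem rootForm_one_tmul (b : D.Base) (α : b.support) (y : Y) :
    rootForm b α (1 ⊗ₜ y) = (D.root' α y : ℝ) := by
  simp [rootForm]

/-- Distinct simple coroots make obtuse angles. -/
theorem rootForm_corootVec_nonpos [Finite ι] (b : D.Base) {α β : b.support} (h : α ≠ β) :
    rootForm b α (corootVec b β) ≤ 0 := by
  have h1 := b.pairingIn_le_zero_of_ne (i := (α : ι)) (j := β)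
    (fun e => h (Subtype.ext e)) α.2 β.2
  have h2 : D.pairingIn ℤ α β = D.pairing α β := by
    simpa using D.algebraMap_pairingIn ℤ (α : ι) β
  rw [corootVec, rootForm_one_tmul, RootPairing.root'_coroot_eq_pairing, ← h2]
  exact_mod_cast h1

/-- With the weights `N α = ⟨α^∨, α^∨⟩` for the Weyl-invariant inner product, the sum is
`2 ∑ᵢ ⟨i, x⟩²`, where `i` runs over all the roots, and hence positive unless `x` is orthogonal to
all of them. -/
theorem exists_weights_posDef [Finite ι] (b : D.Base) :
    ∃ N : b.support → ℝ, (∀ α, 0 < N α) ∧ ∀ c : b.support → ℝ,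
      ∑ α, N α * c α * rootForm b α (∑ β, c β • corootVec b β) ≤ 0 → c = 0 := by
  cases nonempty_fintype ι
  let r : ι → Module.Dual ℝ (A0 Y) := fun i =>
    LinearMap.liftBaseChange ℝ ((Algebra.linearMap ℤ ℝ) ∘ₗ D.root' i)
  have hr : ∀ (i : ι) (s : ℝ) (y : Y), r i (s ⊗ₜ y) = s * (D.root' i y : ℝ) := by
    intro i s y; simp [r]
  let N : b.support → ℤ := fun β => D.CorootForm (D.coroot β) (D.coroot β)
  have hN : ∀ β, 0 < N β := by
    intro β
    simp only [N, RootPairing.corootForm_apply_apply]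
    refine Finset.sum_pos' (fun i _ => mul_self_nonneg _) ⟨β, Finset.mem_univ _, ?_⟩
    simp
  have key : ∀ (β : b.support) (y : A0 Y),
      (N β : ℝ) * rootForm b β y = 2 * ∑ i, (D.root' i (D.coroot β) : ℝ) * r i y := by
    intro β y
    induction y using TensorProduct.induction_on with
    | zero => simp
    | add a c ha hc =>
      simp only [map_add, mul_add, Finset.sum_add_distrib, ha, hc]
    | tmul s y =>
      have h := congrArg (fun z => D.toLinearMap z y) (D.corootForm_self_smul_root (β : ι))
      rw [RootPairing.CoPolarization_apply] at h
      simp only [map_smul, LinearMap.smul_apply, map_sum, map_nsmul,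
        LinearMap.sum_apply, smul_eq_mul] at h
      rw [nsmul_eq_mul] at h
      have h' : (N β : ℝ) * (D.root' β y : ℝ)
          = 2 * ∑ i, (D.root' i (D.coroot β) : ℝ) * (D.root' i y : ℝ) := by
        exact_mod_cast h
      change (N β : ℝ) * r β (s ⊗ₜ y) = _
      simp only [hr]
      rw [mul_left_comm, h', mul_left_comm, Finset.mul_sum]
      congr 1
      exact Finset.sum_congr rfl fun i _ => by ring
  refine ⟨fun β => N β, fun β => Int.cast_pos.2 (hN β), fun c hle => ?_⟩
  set x : A0 Y := ∑ β, c β • corootVec b β with hx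
  have hrx : ∀ i, r i x = ∑ β, c β * (D.root' i (D.coroot β) : ℝ) := by
    intro i
    simp [hx, corootVec, hr]
  have h1 : ∑ α, (N α : ℝ) * c α * rootForm b α x = 2 * ∑ i, r i x * r i x := by
    calc ∑ α, (N α : ℝ) * c α * rootForm b α x
        = ∑ α, ∑ i, 2 * (c α * (D.root' i (D.coroot α) : ℝ) * r i x) := by
          refine Finset.sum_congr rfl fun α _ => ?_
          rw [mul_right_comm, key, ← Finset.mul_sum, mul_assoc, Finset.sum_mul]
          congr 1
          exact Finset.sum_congr rfl fun i _ => by ring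
      _ = 2 * ∑ i, r i x * r i x := by
          rw [Finset.sum_comm, Finset.mul_sum]
          refine Finset.sum_congr rfl fun i _ => ?_
          rw [← Finset.mul_sum, ← Finset.sum_mul, ← hrx i]
  change ∑ α, (N α : ℝ) * c α * rootForm b α x ≤ 0 at hle
  rw [h1] at hle
  have hnn : ∀ i ∈ Finset.univ, 0 ≤ r i x * r i x := fun i _ => mul_self_nonneg _
  have hzero := (Finset.sum_eq_zero_iff_of_nonneg hnn).1
    (le_antisymm (by linarith) (Finset.sum_nonneg hnn))
  have hx0 : x = 0 := by
    refine (Submodule.disjoint_def.1 (disjoint_derivedSpace_centerSpace b Finset.univ)) x ?_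
      (mem_centerSpace.2 fun α _ => mul_self_eq_zero.1 (hzero α (Finset.mem_univ _)))
    exact Submodule.sum_mem _ fun β _ => Submodule.smul_mem _ _
      (Submodule.subset_span ⟨⟨β, Finset.mem_univ β⟩, rfl⟩)
  have hli : LinearIndependent ℝ (fun α : b.support => corootVec b α) :=
    Module.Flat.linearIndependent_one_tmul (S := ℝ) b.linearIndepOn_coroot
  exact funext (Fintype.linearIndependent_iff.1 hli c hx0)

/-- Let `x₊` be the positive part of `x = ∑ c β β^∨`. The coroots being obtuse,
`⟨x₊, x₊⟩ ≤ ⟨x₊, x⟩ ≤ 0`, so that `x₊ = 0`. -/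
theorem coeff_nonpos_of_rootForm_nonpos [Finite ι] (b : D.Base) (c : b.support → ℝ)
    (h : ∀ α, 0 < c α → rootForm b α (∑ β, c β • corootVec b β) ≤ 0) (α : b.support) :
    c α ≤ 0 := by
  obtain ⟨N, hN, hpd⟩ := exists_weights_posDef b
  have hp : (fun α => max (c α) 0) = 0 := by
    refine hpd _ (Finset.sum_nonpos fun α _ => ?_)
    rcases le_or_gt (c α) 0 with hc | hc
    · simp [max_eq_right hc]
    refine mul_nonpos_of_nonneg_of_nonpos (mul_nonneg (hN α).le (le_max_right _ _)) ?_
    refine le_trans ?_ (h α hc)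
    rw [map_sum, map_sum]
    refine Finset.sum_le_sum fun β _ => ?_
    rw [map_smul, map_smul, smul_eq_mul, smul_eq_mul]
    rcases eq_or_ne α β with rfl | hne
    · rw [max_eq_left hc.le]
    · exact mul_le_mul_of_nonpos_right (le_max_left _ _) (rootForm_corootVec_nonpos b hne)
  have := congrFun hp α
  simpa using this

theorem derivedSpace_mono (b : D.Base) {P Q : Parabolic b} (h : P ⊆ Q) :
    derivedSpace b P ≤ derivedSpace b Q := by
  refine Submodule.span_mono ?_
  rintro _ ⟨α, rfl⟩
  exact ⟨⟨α, h α.2⟩, rfl⟩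

theorem centerSpace_anti (b : D.Base) {P Q : Parabolic b} (h : P ⊆ Q) :
    centerSpace b Q ≤ centerSpace b P :=
  fun _ hx => mem_centerSpace.2 fun α hα => mem_centerSpace.1 hx α (h hα)

theorem eqOn_derivedSpace (b : D.Base) {P : Parabolic b} {f g : Module.Dual ℝ (A0 Y)}
    (h : ∀ α ∈ P, f (corootVec b α) = g (corootVec b α)) {x : A0 Y} (hx : x ∈ derivedSpace b P) :
    f x = g x := by
  refine LinearMap.eqOn_span (f := f) (g := g) ?_ hx
  rintro _ ⟨α, rfl⟩
  exact h α α.2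

theorem mem_relSimple {b : D.Base} {P Q : Parabolic b} {α : b.support} :
    α ∈ relSimple b P Q ↔ α ∈ Q ∧ α ∉ P := by
  simp [relSimple]

variable [Finite ι]

theorem proj_mem (b : D.Base) (P : Parabolic b) (x : A0 Y) : proj b P x ∈ centerSpace b P :=
  Submodule.projection_apply_mem _ x

theorem sub_proj_mem (b : D.Base) (P : Parabolic b) (x : A0 Y) :
    x - proj b P x ∈ derivedSpace b P := by
  have h := Submodule.projection_add_projection_eq_self
    (isCompl_derivedSpace_centerSpace b P) x
  have h' : x - proj b P x = (derivedSpace b P).projection (centerSpace b P)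
      (isCompl_derivedSpace_centerSpace b P) x := by
    rw [proj, sub_eq_iff_eq_add]
    exact h.symm
  rw [h']
  exact Submodule.projection_apply_mem _ x

theorem proj_eq_zero (b : D.Base) {P : Parabolic b} {x : A0 Y} (hx : x ∈ derivedSpace b P) :
    proj b P x = 0 :=
  (Submodule.projection_apply_eq_zero_iff _).2 hx

theorem proj_proj (b : D.Base) {P Q : Parabolic b} (h : P ⊆ Q) (x : A0 Y) :
    proj b Q (proj b P x) = proj b Q x := by
  have := proj_eq_zero b (derivedSpace_mono b h (sub_proj_mem b P x))
  rw [map_sub, sub_eq_zero] at this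
  exact this.symm

theorem rootForm_proj_of_mem (b : D.Base) {P : Parabolic b} {α : b.support} (hα : α ∈ P)
    (x : A0 Y) : rootForm b α (proj b P x) = 0 :=
  mem_centerSpace.1 (proj_mem b P x) α hα

theorem proj_sub_proj_mem (b : D.Base) {P Q : Parabolic b} (h : P ⊆ Q) (x : A0 Y) :
    proj b P x - proj b Q x ∈ relSpace b P Q := by
  refine ⟨Submodule.sub_mem _ (proj_mem b P x) (centerSpace_anti b h (proj_mem b Q x)), ?_⟩
  have := sub_proj_mem b Q (proj b P x)
  rwa [proj_proj b h] at this

theorem fundWeight_of_mem_centerSpace (b : D.Base) (Q : Parabolic b) (α : b.support) {x : A0 Y}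
    (hx : x ∈ centerSpace b Q) : fundWeight b Q α x = 0 := by
  unfold fundWeight
  split_ifs with h
  · rw [LinearMap.comp_apply, Submodule.projectionOnto_apply_of_mem_right _ hx, map_zero]
  · rfl

theorem fundWeight_corootVec_eq (b : D.Base) {Q : Parabolic b} {α β : b.support} (hα : α ∈ Q)
    (hβ : β ∈ Q) : fundWeight b Q α (corootVec b β) = if α = β then 1 else 0 := by
  have hm : corootVec b β ∈ derivedSpace b Q := Submodule.subset_span ⟨⟨β, hβ⟩, rfl⟩
  have h1 : (derivedSpace b Q).projectionOnto (centerSpace b Q)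
      (isCompl_derivedSpace_centerSpace b Q) (corootVec b β) = corootBasis b Q ⟨β, hβ⟩ := by
    rw [Submodule.projectionOnto_apply_of_mem_left _ hm]
    exact (Module.Basis.span_apply (linearIndependent_corootVec b Q) ⟨β, hβ⟩).symm
  simp only [fundWeight, hα, dif_pos, LinearMap.comp_apply, h1, Module.Basis.coord_apply,
    Module.Basis.repr_self, Finsupp.single_apply]
  simp [eq_comm]

theorem fundWeight_of_notMem (b : D.Base) {Q : Parabolic b} {α : b.support} (hα : α ∉ Q)
    (x : A0 Y) : fundWeight b Q α x = 0 := by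
  simp [fundWeight, hα]

theorem fundWeight_of_mem_derivedSpace (b : D.Base) {P Q : Parabolic b} (h : P ⊆ Q)
    {α : b.support} (hα : α ∉ P) {x : A0 Y} (hx : x ∈ derivedSpace b P) :
    fundWeight b Q α x = 0 := by
  by_cases hQ : α ∈ Q
  · refine eqOn_derivedSpace b (g := 0) (fun β hβ => ?_) hx
    rw [fundWeight_corootVec_eq b hQ (h hβ), if_neg (by rintro rfl; exact hα hβ)]
    rfl
  · exact fundWeight_of_notMem b hQ x

theorem fundWeight_proj (b : D.Base) {P Q : Parabolic b} (h : P ⊆ Q) {α : b.support}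
    (hα : α ∉ P) (x : A0 Y) : fundWeight b Q α (proj b P x) = fundWeight b Q α x := by
  have := fundWeight_of_mem_derivedSpace b h hα (sub_proj_mem b P x)
  rw [map_sub, sub_eq_zero] at this
  exact this.symm

theorem sum_fundWeight_smul_corootVec (b : D.Base) {Q : Parabolic b} {x : A0 Y}
    (hx : x ∈ derivedSpace b Q) : ∑ α, fundWeight b Q α x • corootVec b α = x := by
  obtain ⟨c, rfl⟩ := (Submodule.mem_span_range_iff_exists_fun ℝ).1 hx
  have : ∀ α : b.support, fundWeight b Q α (∑ β : Q, c β • corootVec b β)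
      = ∑ β : Q, if α = β then c β else 0 := by
    intro α
    by_cases hα : α ∈ Q
    · simp [fundWeight_corootVec_eq b hα]
    · rw [fundWeight_of_notMem b hα, Finset.sum_eq_zero]
      rintro β -
      rw [if_neg]
      rintro rfl
      exact hα β.2
  simp only [this, Finset.sum_smul]
  rw [Finset.sum_comm]
  refine Finset.sum_congr rfl fun β _ => ?_
  simp [ite_smul]

/-- If no simple root of `Δ_P^Q` is positive on `x` together with its fundamental weight, then all
these weights are nonpositive on `x`. -/
theorem fundWeight_nonpos (b : D.Base) {P Q : Parabolic b} {x : A0 Y} (hx : x ∈ relSpace b P Q)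
    (h : ∀ α ∈ relSimple b P Q, 0 < fundWeight b Q α x → rootForm b α x ≤ 0) (α : b.support) :
    fundWeight b Q α x ≤ 0 := by
  refine coeff_nonpos_of_rootForm_nonpos b (fun α => fundWeight b Q α x) (fun α hα => ?_) α
  rw [sum_fundWeight_smul_corootVec b hx.2]
  by_cases hQ : α ∈ Q
  · by_cases hP : α ∈ P
    · exact (mem_centerSpace.1 hx.1 α hP).le
    · exact h α (mem_relSimple.2 ⟨hQ, hP⟩) hα
  · simp [fundWeight_of_notMem b hQ] at hα

/-- On `𝔞_P^Q`, the positive chamber is contained in the open cone spanned by the coroots. -/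
theorem fundWeight_pos (b : D.Base) {P Q : Parabolic b} {x : A0 Y} (hx : x ∈ relSpace b P Q)
    (h : ∀ α ∈ relSimple b P Q, 0 < rootForm b α x) {α : b.support} (hα : α ∈ relSimple b P Q) :
    0 < fundWeight b Q α x := by
  have hnn : ∀ β, 0 ≤ fundWeight b Q β x := by
    intro β
    have := fundWeight_nonpos b (Submodule.neg_mem _ hx)
      (fun γ hγ _ => by rw [map_neg]; exact (neg_neg_of_pos (h γ hγ)).le) β
    simpa using this
  refine lt_of_le_of_ne (hnn α) fun h0 => ?_
  have hpos := h α hα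
  rw [← sum_fundWeight_smul_corootVec b hx.2, map_sum] at hpos
  refine absurd hpos (not_lt.2 (Finset.sum_nonpos fun β _ => ?_))
  rw [map_smul, smul_eq_mul]
  rcases eq_or_ne α β with rfl | hne
  · rw [← h0, zero_mul]
  · exact mul_nonpos_of_nonneg_of_nonpos (hnn β) (rootForm_corootVec_nonpos b hne)

/-- The roots in `Δ_P^Q` form a basis of the dual of `𝔞_P^Q`, so that their values can be
prescribed. -/
theorem exists_mem_relSpace (b : D.Base) {P Q : Parabolic b} (h : P ⊆ Q) (t : b.support → ℝ) :
    ∃ x ∈ relSpace b P Q, ∀ α ∈ relSimple b P Q, rootForm b α x = t α := by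
  let g : derivedSpace b Q →ₗ[ℝ] (Q → ℝ) :=
    (LinearMap.pi fun α : Q => rootForm b α) ∘ₗ (derivedSpace b Q).subtype
  have hg : Function.Injective g := by
    rw [← LinearMap.ker_eq_bot, LinearMap.ker_eq_bot']
    intro x hx
    exact Subtype.ext ((Submodule.disjoint_def.1 (disjoint_derivedSpace_centerSpace b Q)) x x.2
      (mem_centerSpace.2 fun α hα => congrFun hx ⟨α, hα⟩))
  have : FiniteDimensional ℝ (derivedSpace b Q) :=
    FiniteDimensional.span_of_finite ℝ (Set.finite_range _)
  have hdim : Module.finrank ℝ (derivedSpace b Q) = Module.finrank ℝ (Q → ℝ) := by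
    rw [derivedSpace, finrank_span_eq_card (linearIndependent_corootVec b Q)]
    simp
  obtain ⟨x, hx⟩ := (LinearMap.injective_iff_surjective_of_finrank_eq_finrank hdim).1 hg
    (fun α => if (α : b.support) ∈ P then 0 else t α)
  have hx' : ∀ α, ∀ hα : α ∈ Q, rootForm b α x = if α ∈ P then 0 else t α :=
    fun α hα => congrFun hx ⟨α, hα⟩
  refine ⟨x, ⟨mem_centerSpace.2 fun α hα => ?_, x.2⟩, fun α hα => ?_⟩
  · rw [hx' α (h hα), if_pos hα]
  · rw [mem_relSimple] at hα
    rw [hx' α hα.1, if_neg hα.2]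

theorem finrank_relSpace (b : D.Base) {P Q : Parabolic b} (h : P ⊆ Q) :
    Module.finrank ℝ (relSpace b P Q) = (relSimple b P Q).card := by
  let g : relSpace b P Q →ₗ[ℝ] (relSimple b P Q → ℝ) :=
    (LinearMap.pi fun α : relSimple b P Q => rootForm b α) ∘ₗ (relSpace b P Q).subtype
  have hg : Function.Bijective g := by
    constructor
    · rw [← LinearMap.ker_eq_bot, LinearMap.ker_eq_bot']
      intro x hx
      refine Subtype.ext ((Submodule.disjoint_def.1 (disjoint_derivedSpace_centerSpace b Q)) x
        x.2.2 (mem_centerSpace.2 fun α hα => ?_))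
      by_cases hP : α ∈ P
      · exact mem_centerSpace.1 x.2.1 α hP
      · exact congrFun hx ⟨α, mem_relSimple.2 ⟨hα, hP⟩⟩
    · intro t
      obtain ⟨x, hx, hxt⟩ := exists_mem_relSpace b h
        (fun α => if hα : α ∈ relSimple b P Q then t ⟨α, hα⟩ else 0)
      refine ⟨⟨x, hx⟩, funext fun α => ?_⟩
      have := hxt α α.2
      rwa [dif_pos α.2] at this
  rw [(LinearEquiv.ofBijective g hg).finrank_eq]
  simp

theorem chamberAtTop_neBot (b : D.Base) {P Q : Parabolic b} (h : P ⊆ Q) :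
    (chamberAtTop b P Q).NeBot := by
  obtain ⟨x, hx, hx1⟩ := exists_mem_relSpace b h (fun _ => 1)
  have ht : Filter.Tendsto (fun t : ℝ => t • x) Filter.atTop (chamberAtTop b P Q) := by
    refine Filter.tendsto_inf.2 ⟨?_, ?_⟩
    · simp only [Filter.tendsto_iInf, Filter.tendsto_comap_iff]
      intro α hα
      refine Filter.tendsto_id.congr fun t => ?_
      simp [hx1 α hα]
    · refine Filter.tendsto_principal.2 ((Filter.eventually_gt_atTop 0).mono fun t ht => ?_)
      refine ⟨Submodule.smul_mem _ t hx, fun α hα => ?_⟩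
      simpa [hx1 α hα] using ht
  exact ht.neBot

/-- In the relative chamber, the fundamental weights go to infinity together with the roots. -/
theorem tendsto_fundWeight_chamberAtTop (b : D.Base) {P Q : Parabolic b} (h : P ⊆ Q)
    {α : b.support} (hα : α ∈ relSimple b P Q) :
    Filter.Tendsto (fundWeight b Q α) (chamberAtTop b P Q) Filter.atTop := by
  obtain ⟨x, hx, hx1⟩ := exists_mem_relSpace b h (fun _ => 1)
  have hw : 0 < fundWeight b Q α x := fundWeight_pos b hx (fun β hβ => by simp [hx1 β hβ]) hα
  rw [Filter.tendsto_atTop]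
  intro m
  have hroot : ∀ᶠ T in chamberAtTop b P Q, ∀ β ∈ relSimple b P Q,
      m / fundWeight b Q α x < rootForm b β T := by
    refine (Filter.eventually_all_finset _).2 fun β hβ => ?_
    have : Filter.Tendsto (rootForm b β) (chamberAtTop b P Q) Filter.atTop :=
      Filter.tendsto_iff_comap.2 (inf_le_left.trans (iInf₂_le β hβ))
    exact this.eventually_gt_atTop _
  have hmem : ∀ᶠ T in chamberAtTop b P Q, T ∈ chamber b P Q :=
    Filter.mem_inf_of_right (Filter.mem_principal_self _)
  filter_upwards [hroot, hmem] with T hT hTm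
  -- `T - (m / ϖ(x)) x` lies in the chamber, so the weight is positive on it.
  have := fundWeight_pos b
    (Submodule.sub_mem _ hTm.1 (Submodule.smul_mem _ (m / fundWeight b Q α x) hx))
    (fun β hβ => by simpa [hx1 β hβ] using hT β hβ) hα
  rw [map_sub, map_smul, smul_eq_mul, div_mul_cancel₀ _ hw.ne', sub_pos] at this
  exact this.le

end Geometry

/-! ### Arthur's `Γ` and Langlands' combinatorial lemma -/

section Combinatorics

/-- The characteristic function of a condition, with values in `ℤ`. -/
noncomputable def ind (p : Prop) : ℤ := if p then 1 else 0

theorem ind_pos {p : Prop} (h : p) : ind p = 1 := if_pos h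

theorem ind_neg {p : Prop} (h : ¬p) : ind p = 0 := if_neg h

theorem ind_forall {σ : Type*} (t : Finset σ) (p : σ → Prop) :
    ind (∀ α ∈ t, p α) = ∏ α ∈ t, ind (p α) := by
  unfold ind
  rw [Finset.prod_ite_zero, Finset.prod_const_one]
  congr

/-- Expanding `∏_{α ∈ Q \ P} (z α - s α)` for indicators `z` and `s`. -/
theorem sum_powerset_indicator {σ : Type*} [DecidableEq σ] {P Q : Finset σ} (h : P ⊆ Q)
    (z s : σ → Prop) :
    ∑ R ∈ Q.powerset with P ⊆ R, (-1 : ℤ) ^ (Q \ R).card *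
      ind (∀ α ∈ R \ P, z α) * ind (∀ α ∈ Q \ R, s α)
    = ∏ α ∈ Q \ P, (ind (z α) - ind (s α)) := by
  simp only [sub_eq_add_neg, Finset.prod_add]
  refine Finset.sum_bij' (fun R _ => R \ P) (fun t _ => t ∪ P) ?_ ?_ ?_ ?_ ?_
  · intro R hR
    simp only [Finset.mem_filter, Finset.mem_powerset] at hR ⊢
    exact Finset.sdiff_subset_sdiff hR.1 subset_rfl
  · intro t ht
    simp only [Finset.mem_filter, Finset.mem_powerset] at ht ⊢
    exact ⟨Finset.union_subset (ht.trans Finset.sdiff_subset) h, Finset.subset_union_right⟩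
  · intro R hR
    simp only [Finset.mem_filter, Finset.mem_powerset] at hR
    exact Finset.sdiff_union_of_subset hR.2
  · intro t ht
    simp only [Finset.mem_powerset] at ht
    ext x
    have := @ht x
    simp only [Finset.mem_sdiff, Finset.mem_union] at this ⊢
    tauto
  · intro R hR
    simp only [Finset.mem_filter, Finset.mem_powerset] at hR
    have : (Q \ P) \ (R \ P) = Q \ R := by
      ext x
      have := @hR.1 x
      have := @hR.2 x
      simp only [Finset.mem_sdiff]
      tauto
    rw [ind_forall, ind_forall, this, Finset.prod_neg]
    ring

variable {ι X Y : Type*} [AddCommGroup X] [AddCommGroup Y] {D : RootDatum ι X Y}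

theorem tau_eq_ind (b : D.Base) (P Q : Parabolic b) (H : A0 Y) :
    tau b P Q H = ind (∀ α ∈ relSimple b P Q, 0 < rootForm b α H) := by
  unfold tau ind
  congr

variable [Finite ι]

theorem tauHat_eq_ind (b : D.Base) (P Q : Parabolic b) (H : A0 Y) :
    tauHat b P Q H = ind (∀ α ∈ relSimple b P Q, 0 < fundWeight b Q α H) := by
  unfold tauHat ind
  congr

theorem Gam_eq_prod (b : D.Base) {P Q : Parabolic b} (h : P ⊆ Q) (H T : A0 Y) :
    Gam b P Q H T = ∏ α ∈ relSimple b P Q,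
      (ind (0 < rootForm b α H) - ind (0 < fundWeight b Q α (H - T))) := by
  rw [relSimple, ← sum_powerset_indicator h (fun α => 0 < rootForm b α H)
    (fun α => 0 < fundWeight b Q α (H - T))]
  unfold Gam
  refine Finset.sum_congr rfl fun R hR => ?_
  simp only [Finset.mem_filter, Finset.mem_powerset] at hR
  rw [finrank_relSpace b hR.1, tau_eq_ind, tauHat_eq_ind]
  have h1 : (∀ α ∈ relSimple b P R, 0 < rootForm b α (H - proj b R H)) ↔
      ∀ α ∈ R \ P, 0 < rootForm b α H := by
    refine forall₂_congr fun α hα => ?_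
    rw [map_sub, rootForm_proj_of_mem b (mem_relSimple.1 hα).1, sub_zero]
  have h2 : (∀ α ∈ relSimple b R Q, 0 < fundWeight b Q α (proj b R H - proj b R T)) ↔
      ∀ α ∈ Q \ R, 0 < fundWeight b Q α (H - T) := by
    refine forall₂_congr fun α hα => ?_
    rw [← map_sub, fundWeight_proj b hR.1 (mem_relSimple.1 hα).2]
  rw [h1, h2]
  rfl

/-- For `T` in the chamber, `Γ_P^Q(·, T)` is the characteristic function of a truncation of the
chamber. -/
theorem Gam_of_mem_chamber (b : D.Base) {P Q : Parabolic b} (h : P ⊆ Q) {H T : A0 Y}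
    (hH : H ∈ relSpace b P Q) (hT : T ∈ chamber b P Q) :
    Gam b P Q H T = ind (∀ α ∈ relSimple b P Q,
      0 < rootForm b α H ∧ fundWeight b Q α H ≤ fundWeight b Q α T) := by
  rw [Gam_eq_prod b h]
  by_cases hS : ∀ α ∈ relSimple b P Q, fundWeight b Q α (H - T) ≤ 0
  · have hS' : ∀ α ∈ relSimple b P Q, fundWeight b Q α H ≤ fundWeight b Q α T :=
      fun α hα => by simpa using hS α hα
    have : ∏ α ∈ relSimple b P Q, (ind (0 < rootForm b α H) - ind (0 < fundWeight b Q α (H - T)))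
        = ∏ α ∈ relSimple b P Q, ind (0 < rootForm b α H) :=
      Finset.prod_congr rfl fun α hα => by rw [ind_neg (not_lt.2 (hS α hα)), sub_zero]
    rw [this, ← ind_forall]
    congr 1
    exact propext (forall₂_congr fun α hα => (and_iff_left (hS' α hα)).symm)
  · rw [ind_neg fun hc => hS fun α hα => by simpa using (hc α hα).2]
    by_contra hne
    refine hS fun α _ => fundWeight_nonpos b (Submodule.sub_mem _ hH hT.1) (fun β hβ hpos => ?_) α
    have hf := (Finset.prod_ne_zero_iff.1 hne) β hβ
    rw [ind_pos hpos] at hf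
    have : rootForm b β H ≤ 0 := by
      by_contra hc
      rw [ind_pos (not_le.1 hc)] at hf
      exact hf (sub_self 1)
    have hT' := hT.2 β hβ
    rw [map_sub]
    linarith

/-- One of the two forms of Langlands' combinatorial lemma. Both the roots and the weights of a
nonvanishing summand would have to be complementary, which contradicts the acuteness of the chamber
unless `P = Q`. -/
theorem langlands_tau_tauHat (b : D.Base) {P Q : Parabolic b} (h : P ⊆ Q) (H : A0 Y) :
    ∑ R ∈ Q.powerset with P ⊆ R, (-1 : ℤ) ^ (Q \ R).card *
      ind (∀ α ∈ R \ P, 0 < rootForm b α (proj b P H)) *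
      ind (∀ α ∈ Q \ R, 0 < fundWeight b Q α H) = ind (P = Q) := by
  rw [sum_powerset_indicator h]
  by_cases heq : P = Q
  · subst heq
    simp [ind_pos]
  rw [ind_neg heq]
  by_contra hne
  have hf := Finset.prod_ne_zero_iff.1 hne
  set x := proj b P H - proj b Q H with hx
  have hxm : x ∈ relSpace b P Q := proj_sub_proj_mem b h H
  have hroot : ∀ α ∈ Q \ P, rootForm b α x = rootForm b α (proj b P H) := by
    intro α hα
    rw [hx, map_sub, rootForm_proj_of_mem b (Finset.mem_sdiff.1 hα).1, sub_zero]
  have hwt : ∀ α ∈ Q \ P, fundWeight b Q α x = fundWeight b Q α H := by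
    intro α hα
    rw [hx, map_sub, fundWeight_proj b h (Finset.mem_sdiff.1 hα).2,
      fundWeight_of_mem_centerSpace b Q α (proj_mem b Q H), sub_zero]
  have hnonpos : ∀ α, fundWeight b Q α x ≤ 0 := by
    refine fundWeight_nonpos b hxm fun α hα hpos => ?_
    rw [relSimple] at hα
    by_contra hc
    rw [hroot α hα, not_le] at hc
    rw [hwt α hα] at hpos
    have := hf α hα
    rw [ind_pos hc, ind_pos hpos] at this
    exact this (sub_self 1)
  have hpos : ∀ α ∈ relSimple b P Q, 0 < rootForm b α x := by
    intro α hα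
    rw [relSimple] at hα
    by_contra hc
    have := hf α hα
    rw [← hroot α hα, ind_neg hc, ← hwt α hα, ind_neg (not_lt.2 (hnonpos α))] at this
    exact this (sub_self 0)
  obtain ⟨α, hα⟩ : (Q \ P).Nonempty :=
    Finset.sdiff_nonempty.2 fun hQP => heq (h.antisymm hQP)
  exact absurd (fundWeight_pos b hxm hpos (α := α) (by rwa [relSimple]))
    (not_lt.2 (hnonpos α))

/-- The other form of Langlands' combinatorial lemma, which says that the matrices of the two
families of characteristic functions are inverse to each other in the other order. -/
theorem langlands_tauHat_tau (b : D.Base) (P Q : Parabolic b) (H : A0 Y) :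
    ∑ R ∈ Q.powerset with P ⊆ R, (-1 : ℤ) ^ (R \ P).card *
      ind (∀ α ∈ R \ P, 0 < fundWeight b R α H) *
      ind (∀ α ∈ Q \ R, 0 < rootForm b α (proj b R H)) = ind (P = Q) := by
  let t : Matrix (Parabolic b) (Parabolic b) ℤ := fun P Q => if P ⊆ Q then
    ind (∀ α ∈ Q \ P, 0 < rootForm b α (proj b P H)) else 0
  let t' : Matrix (Parabolic b) (Parabolic b) ℤ := fun P Q => if P ⊆ Q then
    (-1 : ℤ) ^ (Q \ P).card * ind (∀ α ∈ Q \ P, 0 < fundWeight b Q α H) else 0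
  have hsum : ∀ (u v : Matrix (Parabolic b) (Parabolic b) ℤ),
      (∀ P Q, ¬ P ⊆ Q → u P Q = 0) → (∀ P Q, ¬ P ⊆ Q → v P Q = 0) → ∀ P Q : Parabolic b,
      (u * v) P Q = ∑ R ∈ Q.powerset with P ⊆ R, u P R * v R Q := by
    intro u v hu hv P Q
    rw [Matrix.mul_apply]
    symm
    refine Finset.sum_subset (Finset.subset_univ _) fun R _ hR => ?_
    simp only [Finset.mem_filter, Finset.mem_powerset, not_and] at hR
    by_cases h1 : R ⊆ Q
    · rw [hu P R (hR h1), zero_mul]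
    · rw [hv R Q h1, mul_zero]
  have ht : ∀ P Q, ¬ P ⊆ Q → t P Q = 0 := fun P Q hPQ => if_neg hPQ
  have ht' : ∀ P Q, ¬ P ⊆ Q → t' P Q = 0 := fun P Q hPQ => if_neg hPQ
  have hmul : t * t' = 1 := by
    ext P Q
    rw [hsum t t' ht ht', Matrix.one_apply]
    by_cases hPQ : P ⊆ Q
    · have h1 : (if P = Q then (1 : ℤ) else 0) = ind (P = Q) := by
        unfold ind
        congr
      rw [h1, ← langlands_tau_tauHat b hPQ H]
      refine Finset.sum_congr rfl fun R hR => ?_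
      simp only [Finset.mem_filter, Finset.mem_powerset] at hR
      simp only [t, t', if_pos hR.1, if_pos hR.2]
      ring
    · rw [if_neg (by rintro rfl; exact hPQ subset_rfl), Finset.sum_eq_zero]
      intro R hR
      simp only [Finset.mem_filter, Finset.mem_powerset] at hR
      exact absurd (hR.2.trans hR.1) hPQ
  have h1 : ind (P = Q) = (t' * t) P Q := by
    rw [mul_eq_one_comm.1 hmul, Matrix.one_apply]
    unfold ind
    congr
  rw [h1, hsum t' t ht' ht]
  refine Finset.sum_congr rfl fun R hR => ?_
  simp only [Finset.mem_filter, Finset.mem_powerset] at hR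
  simp only [t, t', if_pos hR.1, if_pos hR.2]

end Combinatorics

/-! ### Topological types and the coordinates of their slopes -/

section Types

variable {ι X Y : Type*} [AddCommGroup X] [AddCommGroup Y] {D : RootDatum ι X Y}

theorem pushType_trans (b : D.Base) {P Q R : Parabolic b} (h : P ⊆ Q) (h' : Q ⊆ R)
    (ν : TopType b P) : pushType b h' (pushType b h ν) = pushType b (h.trans h') ν := by
  induction ν using Submodule.Quotient.induction_on with | H y => rfl

theorem pushType_refl (b : D.Base) {P : Parabolic b} (h : P ⊆ P) (ν : TopType b P) :
    pushType b h ν = ν := by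
  induction ν using Submodule.Quotient.induction_on with | H y => rfl

variable [Finite ι]

theorem slope_mk (b : D.Base) (P : Parabolic b) (y : Y) :
    slope b P (Submodule.Quotient.mk y) = proj b P (1 ⊗ₜ y) := rfl

theorem slope_pushType (b : D.Base) {P Q : Parabolic b} (h : P ⊆ Q) (ν : TopType b P) :
    slope b Q (pushType b h ν) = proj b Q (slope b P ν) := by
  induction ν using Submodule.Quotient.induction_on with
  | H y => exact (proj_proj b h _).symm

theorem slopeRel_mem (b : D.Base) {P Q : Parabolic b} (h : P ⊆ Q) (ν : TopType b P) :
    slopeRel b P Q ν ∈ relSpace b P Q := by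
  induction ν using Submodule.Quotient.induction_on with
  | H y =>
    rw [slopeRel, slope_mk, proj_proj b h]
    exact proj_sub_proj_mem b h _

theorem rootForm_slopeRel (b : D.Base) (P : Parabolic b) {Q : Parabolic b} {α : b.support}
    (hα : α ∈ Q) (ν : TopType b P) :
    rootForm b α (slopeRel b P Q ν) = rootForm b α (slope b P ν) := by
  rw [slopeRel, map_sub, rootForm_proj_of_mem b hα, sub_zero]

theorem fundWeight_slopeRel (b : D.Base) (P Q : Parabolic b) (α : b.support) (ν : TopType b P) :
    fundWeight b Q α (slopeRel b P Q ν) = fundWeight b Q α (slope b P ν) := by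
  rw [slopeRel, map_sub, fundWeight_of_mem_centerSpace b Q α (proj_mem b Q _), sub_zero]

theorem coe_fundWeight_slope (b : D.Base) {P Q : Parabolic b} (h : P ⊆ Q) {α : b.support}
    (hα : α ∉ P) (ν : TopType b P) :
    ((fundWeight b Q α (slope b P ν) : ℝ) : UnitAddCircle)
      = fundWeightClass b Q α (pushType b h ν) := by
  induction ν using Submodule.Quotient.induction_on with
  | H y =>
    rw [slope_mk, fundWeight_proj b h hα]
    rfl

/-- A topological type of `M_P` is determined by its image for `M_Q` and by the coordinates of its
slope in the basis of coroots of `𝔞_P^Q`. -/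
theorem eq_of_fundWeight_slope_eq (b : D.Base) {P Q : Parabolic b} (h : P ⊆ Q) {ν ν' : TopType b P}
    (hp : pushType b h ν = pushType b h ν') (hw : ∀ α ∈ relSimple b P Q,
      fundWeight b Q α (slope b P ν) = fundWeight b Q α (slope b P ν')) : ν = ν' := by
  rw [← sub_eq_zero] at hp ⊢
  rw [← map_sub] at hp
  replace hw : ∀ α ∈ relSimple b P Q, fundWeight b Q α (slope b P (ν - ν')) = 0 := by
    intro α hα
    rw [map_sub, map_sub, hw α hα, sub_self]
  generalize ν - ν' = μ at hp hw
  induction μ using Submodule.Quotient.induction_on with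
  | H y =>
    have hy : y ∈ corootLattice b Q := (Submodule.Quotient.mk_eq_zero _).1 hp
    obtain ⟨k, rfl⟩ := (Submodule.mem_span_range_iff_exists_fun ℤ).1 hy
    refine (Submodule.Quotient.mk_eq_zero _).2 (Submodule.sum_mem _ fun β _ => ?_)
    by_cases hβ : (β : b.support) ∈ P
    · exact Submodule.smul_mem _ _ (Submodule.subset_span ⟨⟨β, hβ⟩, rfl⟩)
    · have h0 := hw β (mem_relSimple.2 ⟨β.2, hβ⟩)
      have hsum : (1 : ℝ) ⊗ₜ[ℤ] (∑ γ : Q, k γ • D.coroot γ)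
          = ∑ γ : Q, (k γ : ℝ) • corootVec b γ := by
        simp only [TensorProduct.tmul_sum, TensorProduct.tmul_smul, Int.cast_smul_eq_zsmul]
        rfl
      rw [slope_mk, fundWeight_proj b h hβ, hsum, map_sum, Finset.sum_eq_single β] at h0
      · rw [map_smul, fundWeight_corootVec_eq b β.2 β.2, if_pos rfl] at h0
        have : k β = 0 := by simpa using h0
        rw [this, zero_smul]
        exact Submodule.zero_mem _
      · intro γ _ hγ
        rw [map_smul, fundWeight_corootVec_eq b β.2 γ.2,
          if_neg fun e => hγ (Subtype.ext e).symm, smul_zero]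
      · simp

theorem exists_fundWeight_slope_eq (b : D.Base) {P Q : Parabolic b} (h : P ⊆ Q)
    (νQ : TopType b Q) (x : b.support → ℝ)
    (hx : ∀ α ∈ relSimple b P Q, (x α : UnitAddCircle) = fundWeightClass b Q α νQ) :
    ∃ ν : TopType b P, pushType b h ν = νQ ∧
      ∀ α ∈ relSimple b P Q, fundWeight b Q α (slope b P ν) = x α := by
  induction νQ using Submodule.Quotient.induction_on with
  | H y =>
    have hk : ∀ α, ∃ k : ℤ, α ∈ relSimple b P Q → (k : ℝ) = x α - fundWeight b Q α (1 ⊗ₜ y) := by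
      intro α
      by_cases hα : α ∈ relSimple b P Q
      · have h1 : ((x α - fundWeight b Q α (1 ⊗ₜ y) : ℝ) : UnitAddCircle) = 0 := by
          rw [AddCircle.coe_sub, hx α hα, sub_eq_zero]
          rfl
        obtain ⟨k, hk⟩ := (AddCircle.coe_eq_zero_iff (1 : ℝ)).1 h1
        exact ⟨k, fun _ => by simpa using hk⟩
      · exact ⟨0, fun h => absurd h hα⟩
    choose k hk using hk
    have hz : ∑ β ∈ relSimple b P Q, k β • D.coroot β ∈ corootLattice b Q :=
      Submodule.sum_mem _ fun β hβ => Submodule.smul_mem _ _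
        (Submodule.subset_span ⟨⟨β, (mem_relSimple.1 hβ).1⟩, rfl⟩)
    refine ⟨Submodule.Quotient.mk (y + ∑ β ∈ relSimple b P Q, k β • D.coroot β), ?_,
      fun α hα => ?_⟩
    · refine (Submodule.Quotient.eq _).2 ?_
      rwa [LinearMap.id_apply, add_sub_cancel_left]
    · have hsum : (1 : ℝ) ⊗ₜ[ℤ] (∑ γ ∈ relSimple b P Q, k γ • D.coroot γ)
          = ∑ γ ∈ relSimple b P Q, (k γ : ℝ) • corootVec b γ := by
        simp only [TensorProduct.tmul_sum, TensorProduct.tmul_smul, Int.cast_smul_eq_zsmul]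
        rfl
      have hα' := mem_relSimple.1 hα
      rw [slope_mk, fundWeight_proj b h hα'.2, TensorProduct.tmul_add, map_add, hsum, map_sum,
        Finset.sum_eq_single_of_mem α hα]
      · rw [map_smul, fundWeight_corootVec_eq b hα'.1 hα'.1, if_pos rfl, smul_eq_mul, mul_one,
          hk α hα]
        ring
      · intro γ hγ hne
        rw [map_smul, fundWeight_corootVec_eq b hα'.1 (mem_relSimple.1 hγ).1,
          if_neg hne.symm, smul_zero]

theorem posRep_pos (μ : UnitAddCircle) : 0 < posRep μ := (AddCircle.equivIoc (1 : ℝ) 0 μ).2.1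

theorem coe_posRep (μ : UnitAddCircle) : (posRep μ : UnitAddCircle) = μ :=
  (AddCircle.equivIoc (1 : ℝ) 0).symm_apply_apply μ

theorem exists_nat_eq_posRep_add {x : ℝ} (hx : 0 < x) :
    ∃ k : ℕ, x = posRep (x : UnitAddCircle) + k := by
  have h1 : ((x - posRep (x : UnitAddCircle) : ℝ) : UnitAddCircle) = 0 := by
    rw [AddCircle.coe_sub, coe_posRep, sub_self]
  obtain ⟨k, hk⟩ := (AddCircle.coe_eq_zero_iff (1 : ℝ)).1 h1
  have hle : posRep (x : UnitAddCircle) ≤ 0 + 1 := (AddCircle.equivIoc (1 : ℝ) 0 _).2.2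
  have hk' : (k : ℝ) = x - posRep (x : UnitAddCircle) := by simpa using hk
  have hk0 : 0 ≤ k := by
    have : (-1 : ℝ) < k := by linarith
    have : (-1 : ℤ) < k := by exact_mod_cast this
    omega
  lift k to ℕ using hk0
  exact ⟨k, by rw [Int.cast_natCast] at hk'; linarith⟩

theorem finite_coset_inter_Ioc (μ : UnitAddCircle) (m : ℝ) :
    {x : ℝ | (x : UnitAddCircle) = μ ∧ 0 < x ∧ x ≤ m}.Finite := by
  refine ((Set.finite_Iic ⌊m⌋₊).image fun k : ℕ => posRep μ + k).subset ?_
  rintro x ⟨rfl, h0, hm⟩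
  obtain ⟨k, hk⟩ := exists_nat_eq_posRep_add h0
  refine ⟨k, Nat.le_floor ?_, hk.symm⟩
  linarith [posRep_pos (x : UnitAddCircle)]

/-- Only finitely many types over `ν_Q` have a slope in a given box of `𝔞_P^Q`. -/
theorem finite_fundWeight_box (b : D.Base) {P Q : Parabolic b} (h : P ⊆ Q) (νQ : TopType b Q)
    (m : ℝ) : {ν : TopType b P | pushType b h ν = νQ ∧ ∀ α ∈ relSimple b P Q,
      0 < fundWeight b Q α (slope b P ν) ∧ fundWeight b Q α (slope b P ν) ≤ m}.Finite := by
  have hfin : (Set.univ.pi fun α : relSimple b P Q =>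
      {x : ℝ | (x : UnitAddCircle) = fundWeightClass b Q α νQ ∧ 0 < x ∧ x ≤ m}).Finite :=
    Set.Finite.pi fun α => finite_coset_inter_Ioc _ _
  refine Set.Finite.of_finite_image (f := fun ν (α : relSimple b P Q) =>
    fundWeight b Q α (slope b P ν)) (hfin.subset ?_) ?_
  · rintro _ ⟨ν, ⟨hν, hb⟩, rfl⟩ α -
    refine ⟨?_, hb α α.2⟩
    rw [coe_fundWeight_slope b h (mem_relSimple.1 α.2).2, hν]
  · rintro ν ⟨hν, -⟩ ν' ⟨hν', -⟩ heq
    exact eq_of_fundWeight_slope_eq b h (hν.trans hν'.symm) fun α hα => congrFun heq ⟨α, hα⟩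

end Types

/-! ### Sums in adically complete modules -/

section Adic

open Filter Topology

variable {R M : Type*} [CommRing R] {I : Ideal R} [AddCommGroup M] [Module R M]
  [TopologicalSpace M]

theorem isTopologicalAddGroup_of_adic (hM : ‹TopologicalSpace M› = I.adicModuleTopology M) :
    IsTopologicalAddGroup M := by
  subst hM
  let := I.adic_basis.topology
  exact (I.ringFilterBasis.moduleFilterBasis
    (I.adic_module_basis M)).toAddGroupFilterBasis.isTopologicalAddGroup

theorem nhds_hasBasis_of_adic (hM : ‹TopologicalSpace M› = I.adicModuleTopology M) (s : M) :
    (𝓝 s).HasBasis (fun _ : ℕ => True)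
      fun N => {x | x - s ∈ (I ^ N • ⊤ : Submodule R M)} := by
  subst hM
  let := I.adic_basis.topology
  refine ((I.ringFilterBasis.moduleFilterBasis
    (I.adic_module_basis M)).toAddGroupFilterBasis.nhds_hasBasis s).to_hasBasis ?_ ?_
  · rintro _ ⟨N, rfl⟩
    exact ⟨N, trivial, fun x hx => ⟨x - s, hx, add_sub_cancel _ _⟩⟩
  · rintro N -
    refine ⟨_, ⟨N, rfl⟩, ?_⟩
    rintro _ ⟨x, hx, rfl⟩
    simpa using hx

theorem t2Space_of_adic (hM : ‹TopologicalSpace M› = I.adicModuleTopology M) [IsHausdorff I M] :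
    T2Space M := by
  have := isTopologicalAddGroup_of_adic hM
  refine IsTopologicalAddGroup.t2Space_of_zero_sep fun x hx => ?_
  have : ∃ N : ℕ, x ∉ (I ^ N • ⊤ : Submodule R M) := by
    by_contra! hc
    exact hx (IsHausdorff.haus ‹_› x fun N => SModEq.zero.2 (hc N))
  obtain ⟨N, hN⟩ := this
  refine ⟨_, (nhds_hasBasis_of_adic hM 0).mem_of_mem (i := N) trivial, ?_⟩
  simpa using hN

theorem continuousConstSMul_of_adic (hM : ‹TopologicalSpace M› = I.adicModuleTopology M) :
    ContinuousConstSMul R M := by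
  have := isTopologicalAddGroup_of_adic hM
  refine ⟨fun r => continuous_of_continuousAt_zero (DistribSMul.toAddMonoidHom M r) ?_⟩
  have h0 := nhds_hasBasis_of_adic hM (0 : M)
  rw [ContinuousAt, map_zero, h0.tendsto_iff h0]
  exact fun N _ => ⟨N, trivial, fun x hx => by
    simpa using Submodule.smul_mem _ r (by simpa using hx)⟩

/-- In an adically complete module a family that tends to zero is summable. -/
theorem summable_of_adic (hM : ‹TopologicalSpace M› = I.adicModuleTopology M) [IsPrecomplete I M]
    {J : Type*} {f : J → M} (hf : ∀ N : ℕ, {j | f j ∉ (I ^ N • ⊤ : Submodule R M)}.Finite) :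
    Summable f := by
  have key : ∀ (N : ℕ) (F : Finset J), (hf N).toFinset ⊆ F →
      ∑ j ∈ F, f j - ∑ j ∈ (hf N).toFinset, f j ∈ (I ^ N • ⊤ : Submodule R M) := by
    intro N F hF
    rw [← Finset.sum_sdiff hF, add_sub_cancel_right]
    refine Submodule.sum_mem _ fun j hj => ?_
    simpa using (Finset.mem_sdiff.1 hj).2
  obtain ⟨L, hL⟩ := IsPrecomplete.prec (I := I) ‹_›
    (f := fun N => ∑ j ∈ (hf N).toFinset, f j) (fun {m n} hmn => by
      refine (SModEq.sub_mem.2 (key m _ fun j hj => ?_)).symm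
      rw [Set.Finite.mem_toFinset] at hj ⊢
      exact fun hj' => hj (Submodule.smul_mono_left (Ideal.pow_le_pow_right hmn) hj'))
  refine ⟨L, (nhds_hasBasis_of_adic hM L).tendsto_right_iff.2 fun N _ => ?_⟩
  filter_upwards [eventually_ge_atTop (hf N).toFinset] with F hF
  have := Submodule.add_mem _ (key N F hF) (SModEq.sub_mem.1 (hL N))
  rwa [sub_add_sub_cancel] at this

theorem HasSum.exists_finset_of_adic (hM : ‹TopologicalSpace M› = I.adicModuleTopology M)
    {J : Type*} {f : J → M} {s : M} (hf : HasSum f s) (N : ℕ) :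
    ∃ F : Finset J, ∀ F', F ⊆ F' → ∑ j ∈ F', f j - s ∈ (I ^ N • ⊤ : Submodule R M) :=
  eventually_atTop.1 ((nhds_hasBasis_of_adic hM s).tendsto_right_iff.1 hf N trivial)

/-- A partial sum that contains every term outside `I ^ N • ⊤` agrees with the sum modulo
`I ^ N • ⊤`. -/
theorem HasSum.sub_mem_of_adic (hM : ‹TopologicalSpace M› = I.adicModuleTopology M)
    {J : Type*} {f : J → M} {s : M} (hf : HasSum f s) {N : ℕ} {F : Finset J}
    (hF : ∀ j ∉ F, f j ∈ (I ^ N • ⊤ : Submodule R M)) :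
    ∑ j ∈ F, f j - s ∈ (I ^ N • ⊤ : Submodule R M) := by
  obtain ⟨F', hF'⟩ := HasSum.exists_finset_of_adic hM hf N
  have h1 := hF' (F ∪ F') Finset.subset_union_right
  have h2 : ∑ j ∈ (F ∪ F') \ F, f j ∈ (I ^ N • ⊤ : Submodule R M) :=
    Submodule.sum_mem _ fun j hj => hF j (Finset.mem_sdiff.1 hj).2
  rw [← Finset.sum_sdiff (Finset.subset_union_left (s₁ := F) (s₂ := F'))] at h1
  have := Submodule.sub_mem _ h1 h2
  rwa [add_sub_assoc, add_sub_cancel_left] at this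

end Adic

/-! ### The multiple geometric series -/

section Geometric

open Filter Topology

/-- `uv`. -/
noncomputable def uv : PS := MvPowerSeries.X 0 * MvPowerSeries.X 1

theorem uvPow_natCast (k : ℕ) : uvPow k = uv ^ k := by
  rw [uvPow, Nat.floor_natCast, uv]

theorem uvPow_zero : uvPow 0 = 1 := by simp [uvPow]

theorem uvPow_add (k l : ℕ) : uvPow ((k : ℝ) + l) = uvPow k * uvPow l := by
  rw [← Nat.cast_add, uvPow_natCast, uvPow_natCast, uvPow_natCast, pow_add]

theorem uv_pow_mem {k N : ℕ} (h : N ≤ k) : uv ^ k ∈ uvIdeal ^ N := by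
  have huv : uv ∈ uvIdeal := Ideal.mul_mem_right _ _ (Ideal.subset_span (by simp))
  exact Ideal.pow_le_pow_right h (Ideal.pow_mem_pow huv k)

theorem isUnit_one_sub_uv_pow {k : ℕ} (hk : 0 < k) : IsUnit (1 - uv ^ k) := by
  rw [MvPowerSeries.isUnit_iff_constantCoeff]
  simp [uv, hk.ne']

variable {A : Type*} [AddCommGroup A] [Module PS A] [TopologicalSpace A]

/-- The multiple geometric series, with values in a complete module. Its sum over the box
`{k i < N}` is `∏ᵢ (1 - (uv)^{N e i}) / (1 - (uv)^{e i})`, which tends to the product of the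
inverses. -/
theorem hasSum_geometric (hA : ‹TopologicalSpace A› = uvIdeal.adicModuleTopology A)
    [IsAdicComplete uvIdeal A] {σ : Type*} [Fintype σ] (e : σ → ℕ) (he : ∀ i, 0 < e i) (a : A) :
    HasSum (fun k : σ → ℕ => uv ^ (∑ i, e i * k i) • a)
      ((∏ i, Ring.inverse (1 - uv ^ e i)) • a) := by
  have hmem : ∀ N : ℕ, ∀ k ∉ Fintype.piFinset (fun _ : σ => Finset.range N),
      uv ^ (∑ i, e i * k i) • a ∈ (uvIdeal ^ N • ⊤ : Submodule PS A) := by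
    intro N k hk
    simp only [Fintype.mem_piFinset, Finset.mem_range, not_forall, not_lt] at hk
    obtain ⟨i, hi⟩ := hk
    refine Submodule.smul_mem_smul (uv_pow_mem ?_) trivial
    calc N ≤ e i * k i := hi.trans (Nat.le_mul_of_pos_left _ (he i))
      _ ≤ _ := Finset.single_le_sum (f := fun i => e i * k i) (fun _ _ => Nat.zero_le _)
        (Finset.mem_univ i)
  obtain ⟨s, hs⟩ := summable_of_adic hA (f := fun k : σ → ℕ => uv ^ (∑ i, e i * k i) • a)
    fun N => (Finset.finite_toSet _).subset fun k hk => by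
      by_contra hc
      exact hk (hmem N k hc)
  convert hs
  rw [← sub_eq_zero]
  refine IsHausdorff.haus (I := uvIdeal) inferInstance _ fun N => SModEq.zero.2 ?_
  have h1 := HasSum.sub_mem_of_adic hA hs (hmem N)
  have h2 : ∑ k ∈ Fintype.piFinset (fun _ : σ => Finset.range N), uv ^ (∑ i, e i * k i) • a
      = (∏ i, (Ring.inverse (1 - uv ^ e i) * (1 - uv ^ (e i * N)))) • a := by
    rw [← Finset.sum_smul]
    congr 1
    have : ∀ i, Ring.inverse (1 - uv ^ e i) * (1 - uv ^ (e i * N))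
        = ∑ k ∈ Finset.range N, uv ^ (e i * k) := by
      intro i
      have hg := mul_neg_geom_sum (uv ^ e i) N
      simp only [← pow_mul] at hg
      rw [← hg, Ring.inverse_mul_cancel_left _ _ (isUnit_one_sub_uv_pow (he i))]
    simp only [this, Finset.prod_univ_sum, Finset.prod_pow_eq_pow_sum]
  have h3 : ∏ i, (1 - uv ^ (e i * N)) - 1 ∈ uvIdeal ^ N := by
    rw [← Ideal.Quotient.eq_zero_iff_mem, map_sub, map_prod, map_one, sub_eq_zero]
    refine Finset.prod_eq_one fun i _ => ?_
    rw [map_sub, map_one, sub_eq_self, Ideal.Quotient.eq_zero_iff_mem]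
    exact uv_pow_mem (Nat.le_mul_of_pos_left _ (he i))
  have h4 := Submodule.smul_mem_smul (N := (⊤ : Submodule PS A)) h3
    (Submodule.mem_top (x := (∏ i, Ring.inverse (1 - uv ^ e i)) • a))
  rw [h2, Finset.prod_mul_distrib] at h1
  have h5 := Submodule.sub_mem _ h1 h4
  convert h5 using 1
  rw [sub_smul, one_smul, mul_comm, mul_smul]
  abel

end Geometric

/-! ### Exponents of `uv` -/

section Exponents

variable {ι X Y : Type*} [AddCommGroup X] [AddCommGroup Y] {D : RootDatum ι X Y} [Finite ι]

/-- The numerical conditions on `n_P` and `ε₀ᴾ`. -/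
structure IsAdmissible (b : D.Base) (n : Parabolic b → ℕ)
    (ε : Parabolic b → Module.Dual ℝ (A0 Y)) : Prop where
  anti : ∀ P Q : Parabolic b, P ⊆ Q → n Q ≤ n P
  center : ∀ P : Parabolic b, ∀ x ∈ centerSpace b P, ε P x = 0
  derived : ∀ P Q : Parabolic b, P ⊆ Q → ∀ x ∈ derivedSpace b P, (ε Q - ε P) x = 0
  pos : ∀ P Q : Parabolic b, P ⊆ Q → ∀ α ∈ relSimple b P Q,
    ∃ k : ℤ, 0 < k ∧ (ε Q - ε P) (relCoroot b P α) = k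
  even : ∀ (P Q : Parabolic b) (h : P ⊆ Q) (ν : TopType b P),
    ∃ k : ℤ, mFun b n ε P ν - mFun b n ε Q (pushType b h ν) = 2 * k

namespace IsAdmissible

variable {b : D.Base} {n : Parabolic b → ℕ} {ε : Parabolic b → Module.Dual ℝ (A0 Y)}

theorem eps_proj (hb : IsAdmissible b n ε) {P Q : Parabolic b} (h : P ⊆ Q) (x : A0 Y) :
    (ε Q - ε P) (proj b P x) = (ε Q - ε P) x := by
  have := hb.derived P Q h _ (sub_proj_mem b P x)
  rw [map_sub, sub_eq_zero] at this
  exact this.symm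

theorem eps_of_mem_centerSpace (hb : IsAdmissible b n ε) {P Q : Parabolic b} (h : P ⊆ Q)
    {x : A0 Y} (hx : x ∈ centerSpace b Q) : (ε Q - ε P) x = 0 := by
  rw [LinearMap.sub_apply, hb.center Q x hx, hb.center P x (centerSpace_anti b h hx), sub_zero]

theorem eps_eq_sum (hb : IsAdmissible b n ε) {P Q : Parabolic b} (h : P ⊆ Q) (x : A0 Y) :
    (ε Q - ε P) x = ∑ α ∈ relSimple b P Q, (ε Q - ε P) (relCoroot b P α) * fundWeight b Q α x := by
  have hd : (ε Q - ε P) x = (ε Q - ε P) (x - proj b Q x) := by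
    rw [map_sub, hb.eps_of_mem_centerSpace h (proj_mem b Q x), sub_zero]
  have hw : ∀ α, fundWeight b Q α x = fundWeight b Q α (x - proj b Q x) := by
    intro α
    rw [map_sub, fundWeight_of_mem_centerSpace b Q α (proj_mem b Q x), sub_zero]
  simp only [hw]
  rw [hd]
  conv_lhs => rw [← sum_fundWeight_smul_corootVec b (sub_proj_mem b Q x), map_sum]
  symm
  refine (Finset.sum_subset (Finset.subset_univ _) fun α _ hα => ?_).trans
    (Finset.sum_congr rfl fun α _ => ?_)
  · by_cases hQ : α ∈ Q
    · have hP : α ∈ P := by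
        by_contra hP
        exact hα (mem_relSimple.2 ⟨hQ, hP⟩)
      rw [relCoroot, proj_corootVec b ⟨α, hP⟩, map_zero, zero_mul]
    · rw [fundWeight_of_notMem b hQ, mul_zero]
  · rw [map_smul, smul_eq_mul, relCoroot, hb.eps_proj h, mul_comm]

theorem mFun_sub (hb : IsAdmissible b n ε) {P Q : Parabolic b} (h : P ⊆ Q) (ν : TopType b P) :
    mFun b n ε P ν - mFun b n ε Q (pushType b h ν) = n P - n Q +
      ∑ α ∈ relSimple b P Q, (ε Q - ε P) (relCoroot b P α) * fundWeight b Q α (slope b P ν) := by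
  rw [← hb.eps_eq_sum h, mFun, mFun, slope_pushType, hb.eps_proj (Finset.subset_univ Q)]
  simp only [LinearMap.sub_apply]
  ring

theorem exists_n_eq (hb : IsAdmissible b n ε) {P Q : Parabolic b} (h : P ⊆ Q) :
    ∃ d : ℕ, (n P : ℝ) - n Q = 2 * d := by
  obtain ⟨k, hk⟩ := hb.even P Q h 0
  rw [hb.mFun_sub h, map_zero] at hk
  simp only [map_zero, mul_zero, Finset.sum_const_zero, add_zero] at hk
  have hle : (n Q : ℝ) ≤ n P := by exact_mod_cast hb.anti P Q h
  have hk0 : 0 ≤ k := by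
    have : (0 : ℝ) ≤ k := by linarith
    exact_mod_cast this
  lift k to ℕ using hk0
  exact ⟨k, by simpa using hk⟩

theorem exists_coeff_eq (hb : IsAdmissible b n ε) {P Q : Parabolic b} (h : P ⊆ Q)
    {α : b.support} (hα : α ∈ relSimple b P Q) :
    ∃ j : ℕ, 0 < j ∧ (ε Q - ε P) (relCoroot b P α) = 2 * j := by
  obtain ⟨d, hd⟩ := hb.exists_n_eq h
  obtain ⟨c, hc0, hc⟩ := hb.pos P Q h α hα
  obtain ⟨k, hk⟩ := hb.even P Q h (Submodule.Quotient.mk (D.coroot α))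
  rw [hb.mFun_sub h, ← hb.eps_eq_sum h, slope_mk, hd] at hk
  change 2 * (d : ℝ) + (ε Q - ε P) (relCoroot b P α) = 2 * k at hk
  rw [hc] at hk
  have hk' : 2 * (d : ℤ) + c = 2 * k := by exact_mod_cast hk
  have hkd : 0 ≤ k - d := by omega
  obtain ⟨j, hj⟩ := Int.eq_ofNat_of_zero_le hkd
  refine ⟨j, by omega, ?_⟩
  rw [hc]
  have : c = 2 * (j : ℤ) := by omega
  exact_mod_cast this

/-- The exponents of `uv` at the types whose slope is in the open cone spanned by the coroots are
nonnegative integers, and they bound the slope. -/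
theorem exists_exponent_eq (hb : IsAdmissible b n ε) {P Q : Parabolic b} (h : P ⊆ Q)
    {ν : TopType b P} (hν : ∀ α ∈ relSimple b P Q, 0 < fundWeight b Q α (slope b P ν)) :
    ∃ k : ℕ, (mFun b n ε P ν - mFun b n ε Q (pushType b h ν)) / 2 = k ∧
      ∀ α ∈ relSimple b P Q, fundWeight b Q α (slope b P ν) ≤ k := by
  obtain ⟨d, hd⟩ := hb.exists_n_eq h
  obtain ⟨k, hk⟩ := hb.even P Q h ν
  have hterm : ∀ α ∈ relSimple b P Q, 2 * fundWeight b Q α (slope b P ν) ≤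
      (ε Q - ε P) (relCoroot b P α) * fundWeight b Q α (slope b P ν) := by
    intro α hα
    obtain ⟨j, hj0, hj⟩ := hb.exists_coeff_eq h hα
    have : (1 : ℝ) ≤ j := by exact_mod_cast hj0
    rw [hj]
    exact mul_le_mul_of_nonneg_right (by linarith) (hν α hα).le
  have hnn : ∀ α ∈ relSimple b P Q,
      0 ≤ (ε Q - ε P) (relCoroot b P α) * fundWeight b Q α (slope b P ν) :=
    fun α hα => le_trans (by linarith [hν α hα]) (hterm α hα)
  have heq := hb.mFun_sub h ν
  rw [hk, hd] at heq
  have hd0 : (0 : ℝ) ≤ d := d.cast_nonneg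
  have hk0 : 0 ≤ k := by
    have : (0 : ℝ) ≤ k := by linarith [Finset.sum_nonneg hnn]
    exact_mod_cast this
  lift k to ℕ using hk0
  rw [Int.cast_natCast] at heq hk
  refine ⟨k, by rw [hk]; ring, fun α hα => ?_⟩
  have := (hterm α hα).trans (Finset.single_le_sum hnn hα)
  linarith

end IsAdmissible

end Exponents

/-! ### Sums over topological types -/

section Sums

variable {ι X Y : Type*} [AddCommGroup X] [AddCommGroup Y] {D : RootDatum ι X Y} [Finite ι]
  {A : Type*} [AddCommGroup A] [Module PS A] [TopologicalSpace A]

theorem tau_slopeRel (b : D.Base) (P Q : Parabolic b) (ν : TopType b P) :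
    tau b P Q (slopeRel b P Q ν) = tau b P Q (slope b P ν) := by
  rw [tau_eq_ind, tau_eq_ind]
  congr 1
  exact propext (forall₂_congr fun α hα => by rw [rootForm_slopeRel b P (mem_relSimple.1 hα).1])

/-- An unconditionally convergent sum over the chamber is the limit of the sums truncated by
Arthur's functions `Γ_P^Q`. -/
theorem hasTauSum_of_hasSum (hA : ‹TopologicalSpace A› = uvIdeal.adicModuleTopology A)
    (b : D.Base) {P Q : Parabolic b} (h : P ⊆ Q) (νQ : TopType b Q) (f : TopType b P → A) {s : A}
    (hs : HasSum (fun ν : {ν : TopType b P // pushType b h ν = νQ} =>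
      tau b P Q (slope b P ν) • f ν) s) : HasTauSum b h νQ f s := by
  unfold HasTauSum
  rw [← hA, (nhds_hasBasis_of_adic hA s).tendsto_right_iff]
  intro N _
  obtain ⟨F, hF⟩ := HasSum.exists_finset_of_adic hA hs N
  have hmem : ∀ᶠ T in chamberAtTop b P Q, T ∈ chamber b P Q :=
    Filter.mem_inf_of_right (Filter.mem_principal_self _)
  have hbig : ∀ᶠ T in chamberAtTop b P Q, ∀ ν ∈ F, ∀ α ∈ relSimple b P Q,
      fundWeight b Q α (slope b P ν) ≤ fundWeight b Q α T :=
    (Filter.eventually_all_finset _).2 fun ν _ => (Filter.eventually_all_finset _).2 fun α hα =>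
      (tendsto_fundWeight_chamberAtTop b h hα).eventually_ge_atTop _
  filter_upwards [hmem, hbig] with T hT hTF
  have hG : ∀ ν : TopType b P, Gam b P Q (slopeRel b P Q ν) T = ind (∀ α ∈ relSimple b P Q,
      0 < rootForm b α (slopeRel b P Q ν) ∧
        fundWeight b Q α (slope b P ν) ≤ fundWeight b Q α T) := by
    intro ν
    rw [Gam_of_mem_chamber b h (slopeRel_mem b h ν) hT]
    simp only [fundWeight_slopeRel]
  obtain ⟨m, hm⟩ : ∃ m : ℝ, ∀ α ∈ relSimple b P Q, fundWeight b Q α T ≤ m := by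
    obtain ⟨m, hm⟩ := ((relSimple b P Q).image fun α => fundWeight b Q α T).bddAbove
    exact ⟨m, fun α hα => hm (Finset.mem_coe.2 (Finset.mem_image_of_mem _ hα))⟩
  have hfin : {ν : {ν : TopType b P // pushType b h ν = νQ} |
      Gam b P Q (slopeRel b P Q ν) T ≠ 0}.Finite := by
    refine Set.Finite.of_finite_image ((finite_fundWeight_box b h νQ m).subset ?_)
      Subtype.val_injective.injOn
    rintro _ ⟨ν, hν, rfl⟩
    have hc : ∀ α ∈ relSimple b P Q, 0 < rootForm b α (slopeRel b P Q ν) ∧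
        fundWeight b Q α (slope b P ν) ≤ fundWeight b Q α T := by
      by_contra hc
      exact hν (by rw [hG, ind_neg hc])
    refine ⟨ν.2, fun α hα => ⟨?_, (hc α hα).2.trans (hm α hα)⟩⟩
    rw [← fundWeight_slopeRel]
    exact fundWeight_pos b (slopeRel_mem b h ν.1) (fun β hβ => (hc β hβ).1) hα
  -- On `F`, and wherever `Γ_P^Q(·, T)` does not vanish, it agrees with `τ_P^Q`.
  rw [finsum_eq_sum_of_support_subset (s := F ∪ hfin.toFinset)]
  · rw [Finset.sum_congr rfl]
    · exact hF _ Finset.subset_union_left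
    · intro ν hν
      congr 1
      rw [← tau_slopeRel, tau_eq_ind]
      by_cases hG0 : Gam b P Q (slopeRel b P Q ν) T = 0
      · have hνF : ν ∈ F := (Finset.mem_union.1 hν).resolve_right (by simp [hG0])
        rw [hG]
        congr 1
        exact propext (forall₂_congr fun α hα => and_iff_left (hTF ν hνF α hα))
      · rw [hG] at hG0 ⊢
        have hc : ∀ α ∈ relSimple b P Q, 0 < rootForm b α (slopeRel b P Q ν) ∧
            fundWeight b Q α (slope b P ν) ≤ fundWeight b Q α T := by
          by_contra hc
          exact hG0 (ind_neg hc)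
        rw [ind_pos hc, ind_pos fun α hα => (hc α hα).1]
  · intro ν hν
    refine Finset.mem_coe.2 (Finset.mem_union_right _ ?_)
    rw [Set.Finite.mem_toFinset]
    intro h0
    exact hν (by simp only [h0, zero_smul])

/-- The coefficient of `a₀(P)` in the closed formula for `b₀(Q, ν_Q)`, up to its sign. -/
noncomputable def closedCoeff (b : D.Base) (n : Parabolic b → ℕ)
    (ε : Parabolic b → Module.Dual ℝ (A0 Y)) (P Q : Parabolic b) (νQ : TopType b Q) : PS :=
  uvPow (((n P : ℝ) - n Q) / 2) *
    (∏ α ∈ relSimple b P Q, Ring.inverse (1 - uvPow ((ε Q - ε P) (relCoroot b P α) / 2))) *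
    uvPow ((∑ α ∈ relSimple b P Q,
      (ε Q - ε P) (relCoroot b P α) * posRep (fundWeightClass b Q α νQ)) / 2)

/-- Expanding the geometric series, the closed formula becomes a sum over the types `ν_P` over `ν_Q`
whose slope is in the open cone spanned by the coroots: the coordinates of such a slope are
`⟨ϖ_α(ν_Q)⟩ + k_α` with `k_α ≥ 0`. -/
theorem hasSum_closedCoeff (hA : ‹TopologicalSpace A› = uvIdeal.adicModuleTopology A)
    [IsAdicComplete uvIdeal A] {b : D.Base} {n : Parabolic b → ℕ}
    {ε : Parabolic b → Module.Dual ℝ (A0 Y)} (hb : IsAdmissible b n ε) {P Q : Parabolic b}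
    (h : P ⊆ Q) (νQ : TopType b Q) (a : A) :
    HasSum (fun ν : {ν : TopType b P // pushType b h ν = νQ} => tauHat b P Q (slope b P ν) •
      uvPow ((mFun b n ε P ν - mFun b n ε Q νQ) / 2) • a) (closedCoeff b n ε P Q νQ • a) := by
  have := continuousConstSMul_of_adic hA
  obtain ⟨d, hd⟩ := hb.exists_n_eq h
  choose j hj0 hj using fun α : relSimple b P Q => hb.exists_coeff_eq h α.2
  have hex : ∀ k : relSimple b P Q → ℕ, ∃ ν : {ν : TopType b P // pushType b h ν = νQ},
      ∀ α : relSimple b P Q, fundWeight b Q α (slope b P ν)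
        = posRep (fundWeightClass b Q α νQ) + k α := by
    intro k
    obtain ⟨ν, hν, hw⟩ := exists_fundWeight_slope_eq b h νQ
      (fun α => posRep (fundWeightClass b Q α νQ)
        + if hα : α ∈ relSimple b P Q then (k ⟨α, hα⟩ : ℝ) else 0) (fun α hα => by
        rw [dif_pos hα, AddCircle.coe_add, coe_posRep, add_eq_left]
        exact (AddCircle.coe_eq_zero_iff (1 : ℝ)).2 ⟨k ⟨α, hα⟩, by simp⟩)
    exact ⟨⟨ν, hν⟩, fun α => by rw [hw α α.2, dif_pos α.2]⟩
  -- `φ` parametrizes the support of the family.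
  choose φ hφ using hex
  have hφpos : ∀ k, ∀ α ∈ relSimple b P Q, 0 < fundWeight b Q α (slope b P (φ k)) := by
    intro k α hα
    rw [hφ k ⟨α, hα⟩]
    exact add_pos_of_pos_of_nonneg (posRep_pos _) (Nat.cast_nonneg _)
  have hinj : Function.Injective φ := by
    intro k l hkl
    funext α
    have := hφ k α
    rw [hkl, hφ l α, add_right_inj] at this
    exact_mod_cast this.symm
  have hrange : ∀ ν, ν ∉ Set.range φ → tauHat b P Q (slope b P ν.1) •
      uvPow ((mFun b n ε P ν - mFun b n ε Q νQ) / 2) • a = 0 := by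
    intro ν hν
    rw [tauHat_eq_ind, ind_neg, zero_smul]
    intro hpos
    choose k hk using fun α : relSimple b P Q => exists_nat_eq_posRep_add (hpos α α.2)
    refine hν ⟨k, Subtype.ext (eq_of_fundWeight_slope_eq b h ((φ k).2.trans ν.2.symm) ?_)⟩
    intro α hα
    rw [hφ k ⟨α, hα⟩, hk ⟨α, hα⟩, coe_fundWeight_slope b h (mem_relSimple.1 hα).2, ν.2]
  have hexp : ∀ k, (mFun b n ε P (φ k) - mFun b n ε Q νQ) / 2
      = d + ∑ α, j α * posRep (fundWeightClass b Q α νQ) + ∑ α, (j α : ℝ) * k α := by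
    intro k
    have := hb.mFun_sub h (φ k).1
    rw [(φ k).2, hd, ← Finset.sum_coe_sort] at this
    rw [this, add_assoc, ← Finset.sum_add_distrib, add_div, Finset.sum_div]
    congr 1
    · ring
    · refine Finset.sum_congr rfl fun α _ => ?_
      rw [hφ, hj]
      ring
  obtain ⟨E, hE⟩ : ∃ E : ℕ, ∑ α, j α * posRep (fundWeightClass b Q α νQ) = E := by
    obtain ⟨m, hm, -⟩ := hb.exists_exponent_eq h (hφpos 0)
    rw [(φ 0).2, hexp] at hm
    simp only [Pi.zero_apply, Nat.cast_zero, mul_zero, Finset.sum_const_zero, add_zero] at hm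
    have hnn : 0 ≤ ∑ α, j α * posRep (fundWeightClass b Q α νQ) :=
      Finset.sum_nonneg fun α _ => mul_nonneg (Nat.cast_nonneg _) (posRep_pos _).le
    have hdm : d ≤ m := by
      have : (d : ℝ) ≤ m := by linarith
      exact_mod_cast this
    exact ⟨m - d, by rw [Nat.cast_sub hdm]; linarith⟩
  have hcoeff : closedCoeff b n ε P Q νQ
      = uv ^ (d + E) * ∏ α, Ring.inverse (1 - uv ^ j α) := by
    rw [closedCoeff, ← Finset.sum_coe_sort, ← Finset.prod_coe_sort, hd]
    have h1 : (∑ α : relSimple b P Q,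
        (ε Q - ε P) (relCoroot b P α) * posRep (fundWeightClass b Q α νQ)) / 2 = E := by
      rw [← hE, Finset.sum_div]
      refine Finset.sum_congr rfl fun α _ => ?_
      rw [hj]
      ring
    have h2 : ∀ α : relSimple b P Q, (ε Q - ε P) (relCoroot b P α) / 2 = j α := by
      intro α
      rw [hj]
      ring
    simp only [h1, h2, uvPow_natCast]
    rw [mul_div_cancel_left₀ _ (two_ne_zero' ℝ), uvPow_natCast, pow_add]
    ring
  rw [← hinj.hasSum_iff hrange, hcoeff, mul_smul]
  refine ((hasSum_geometric hA j hj0 a).const_smul (uv ^ (d + E))).congr_fun ?_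
  intro k
  have hpos : ∀ α ∈ relSimple b P Q, 0 < fundWeight b Q α (slope b P (φ k).1) := hφpos k
  have hnat : (d : ℝ) + E + ∑ α, (j α : ℝ) * k α = ((d + E + ∑ α, j α * k α : ℕ) : ℝ) := by
    push_cast
    rfl
  rw [Function.comp_apply, tauHat_eq_ind, ind_pos hpos, one_smul, hexp, hE, hnat, uvPow_natCast,
    pow_add, mul_smul]

end Sums

/-! ### The inversion -/

section Inversion

variable {ι X Y : Type*} [AddCommGroup X] [AddCommGroup Y] {D : RootDatum ι X Y} [Finite ι]
  {A : Type*} [AddCommGroup A] [Module PS A]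

/-- A type of `M_P` over `ν_R` amounts to a type `ν_Q` of `M_Q` over `ν_R` and a type of `M_P`
over `ν_Q`. -/
def fiberEquiv (b : D.Base) {P Q R : Parabolic b} (h : P ⊆ Q) (h' : Q ⊆ R) (νR : TopType b R) :
    (Σ νQ : {νQ : TopType b Q // pushType b h' νQ = νR},
      {ν : TopType b P // pushType b h ν = νQ.1}) ≃
    {ν : TopType b P // pushType b (h.trans h') ν = νR} where
  toFun x := ⟨x.2.1, by rw [← pushType_trans b h h', x.2.2, x.1.2]⟩
  invFun ν := ⟨⟨pushType b h ν.1, by rw [pushType_trans, ν.2]⟩, ⟨ν.1, rfl⟩⟩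
  left_inv := by
    rintro ⟨⟨νQ, hQ⟩, ⟨ν, hν⟩⟩
    change pushType b h ν = νQ at hν
    subst hν
    rfl
  right_inv _ := rfl

/-- The characteristic function that enters when the closed formula is substituted into the
recursion. -/
noncomputable def middleInd (b : D.Base) (P Q R : Parabolic b) (x : A0 Y) : ℤ :=
  tauHat b P Q x * tau b Q R (proj b Q x)

theorem sum_middleInd (b : D.Base) (P R : Parabolic b) (x : A0 Y) :
    ∑ Q ∈ R.powerset with P ⊆ Q, (-1 : ℤ) ^ Module.finrank ℝ (relSpace b P Q) *
      middleInd b P Q R x = ind (P = R) := by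
  rw [← langlands_tauHat_tau b P R x]
  refine Finset.sum_congr rfl fun Q hQ => ?_
  simp only [Finset.mem_filter, Finset.mem_powerset] at hQ
  rw [finrank_relSpace b hQ.2, middleInd, tauHat_eq_ind, tau_eq_ind, mul_assoc]
  rfl

theorem fundWeight_pos_of_tau (b : D.Base) {P Q : Parabolic b} (h : P ⊆ Q) {ν : TopType b P}
    (hν : ∀ α ∈ relSimple b P Q, 0 < rootForm b α (slope b P ν)) :
    ∀ α ∈ relSimple b P Q, 0 < fundWeight b Q α (slope b P ν) := by
  intro α hα
  rw [← fundWeight_slopeRel]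
  exact fundWeight_pos b (slopeRel_mem b h ν)
    (fun β hβ => by rw [rootForm_slopeRel b P (mem_relSimple.1 hβ).1]; exact hν β hβ) hα

variable {b : D.Base} {n : Parabolic b → ℕ} {ε : Parabolic b → Module.Dual ℝ (A0 Y)}

/-- On the support of `middleInd` the exponents are nonnegative integers and add up. Elsewhere both
sides vanish, so that the value of `uvPow` at a negative number does not matter. -/
theorem middleInd_smul_uvPow (hb : IsAdmissible b n ε) {P Q R : Parabolic b} (h : P ⊆ Q)
    (h' : Q ⊆ R) (ν : TopType b P) (a : A) :
    middleInd b P Q R (slope b P ν) •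
      uvPow ((mFun b n ε P ν - mFun b n ε R (pushType b (h.trans h') ν)) / 2) • a =
    tau b Q R (slope b Q (pushType b h ν)) •
      uvPow ((mFun b n ε Q (pushType b h ν) - mFun b n ε R (pushType b (h.trans h') ν)) / 2) •
      tauHat b P Q (slope b P ν) •
      uvPow ((mFun b n ε P ν - mFun b n ε Q (pushType b h ν)) / 2) • a := by
  rw [middleInd, ← slope_pushType b h, tauHat_eq_ind, tau_eq_ind]
  by_cases h1 : ∀ α ∈ relSimple b P Q, 0 < fundWeight b Q α (slope b P ν)
  · by_cases h2 : ∀ α ∈ relSimple b Q R, 0 < rootForm b α (slope b Q (pushType b h ν))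
    · obtain ⟨k, hk, -⟩ := hb.exists_exponent_eq h h1
      obtain ⟨l, hl, -⟩ := hb.exists_exponent_eq h' (fundWeight_pos_of_tau b h' h2)
      rw [pushType_trans] at hl
      have hkl : (mFun b n ε P ν - mFun b n ε R (pushType b (h.trans h') ν)) / 2
          = (l : ℝ) + k := by
        rw [← hk, ← hl]
        ring
      rw [ind_pos h1, ind_pos h2, hk, hl, hkl, uvPow_add]
      simp only [mul_one, one_smul, mul_smul]
    · rw [ind_neg h2, mul_zero, zero_smul, zero_smul]
  · rw [ind_neg h1, zero_mul, zero_smul, zero_smul, smul_zero, smul_zero]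

theorem finite_middleInd (hb : IsAdmissible b n ε) {P Q R : Parabolic b} (h : P ⊆ Q)
    (h' : Q ⊆ R) (νR : TopType b R) (a : A) (N : ℕ) :
    {ν : {ν : TopType b P // pushType b (h.trans h') ν = νR} |
      middleInd b P Q R (slope b P ν.1) • uvPow ((mFun b n ε P ν - mFun b n ε R νR) / 2) • a ∉
        (uvIdeal ^ N • ⊤ : Submodule PS A)}.Finite := by
  refine Set.Finite.of_finite_image (f := Subtype.val) (Set.Finite.subset
    ((finite_fundWeight_box b h' νR N).biUnion fun νQ _ => finite_fundWeight_box b h νQ N) ?_)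
    Subtype.val_injective.injOn
  rintro _ ⟨⟨ν, rfl⟩, hν, rfl⟩
  change middleInd b P Q R (slope b P ν) •
    uvPow ((mFun b n ε P ν - mFun b n ε R (pushType b (h.trans h') ν)) / 2) • a ∉
      (uvIdeal ^ N • ⊤ : Submodule PS A) at hν
  rw [middleInd_smul_uvPow hb h h', tauHat_eq_ind, tau_eq_ind] at hν
  by_cases h1 : ∀ α ∈ relSimple b P Q, 0 < fundWeight b Q α (slope b P ν)
  swap
  · rw [ind_neg h1, zero_smul, smul_zero, smul_zero] at hν
    exact absurd (Submodule.zero_mem _) hν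
  by_cases h2 : ∀ α ∈ relSimple b Q R, 0 < rootForm b α (slope b Q (pushType b h ν))
  swap
  · rw [ind_neg h2, zero_smul] at hν
    exact absurd (Submodule.zero_mem _) hν
  have h3 := fundWeight_pos_of_tau b h' h2
  obtain ⟨k, hk, hk'⟩ := hb.exists_exponent_eq h h1
  obtain ⟨l, hl, hl'⟩ := hb.exists_exponent_eq h' h3
  rw [pushType_trans] at hl
  rw [ind_pos h1, ind_pos h2, one_smul, one_smul, hk, hl, uvPow_natCast, uvPow_natCast,
    smul_smul, ← pow_add] at hν
  have hlt : l + k < N := by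
    by_contra hc
    exact hν (Submodule.smul_mem_smul (uv_pow_mem (not_lt.1 hc)) trivial)
  have hkN : (k : ℝ) ≤ N := by exact_mod_cast (by omega : k ≤ N)
  have hlN : (l : ℝ) ≤ N := by exact_mod_cast (by omega : l ≤ N)
  refine Set.mem_biUnion (x := pushType b h ν) ⟨pushType_trans b h h' ν, fun α hα => ⟨h3 α hα, ?_⟩⟩
    ⟨rfl, fun α hα => ⟨h1 α hα, (hk' α hα).trans hkN⟩⟩
  exact (hl' α hα).trans hlN

theorem hasSum_middleInd_fiberwise [TopologicalSpace A]
    (hA : ‹TopologicalSpace A› = uvIdeal.adicModuleTopology A)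
    [IsAdicComplete uvIdeal A] (hb : IsAdmissible b n ε) {P Q R : Parabolic b} (h : P ⊆ Q)
    (h' : Q ⊆ R) (νR : TopType b R) {a s : A}
    (hs : HasSum (fun ν : {ν : TopType b P // pushType b (h.trans h') ν = νR} =>
      middleInd b P Q R (slope b P ν.1) • uvPow ((mFun b n ε P ν - mFun b n ε R νR) / 2) • a) s) :
    HasSum (fun νQ : {νQ : TopType b Q // pushType b h' νQ = νR} =>
      tau b Q R (slope b Q νQ) • uvPow ((mFun b n ε Q νQ - mFun b n ε R νR) / 2) •
        closedCoeff b n ε P Q νQ • a) s := by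
  have := isTopologicalAddGroup_of_adic hA
  have := continuousConstSMul_of_adic hA
  rw [← (fiberEquiv b h h' νR).hasSum_iff] at hs
  refine HasSum.sigma hs ?_
  rintro ⟨νQ, rfl⟩
  refine (((hasSum_closedCoeff hA hb h νQ a).const_smul _).const_smul _).congr_fun ?_
  rintro ⟨ν, rfl⟩
  have := middleInd_smul_uvPow hb h h' ν a
  rw [← pushType_trans b h h'] at this
  exact this

/-- The closed formula solves the recursion: by Langlands' combinatorial lemma everything but the
term `a₀(Q)` cancels. -/
theorem satisfiesRecursion_closedFormula [IsAdicComplete uvIdeal A] (hb : IsAdmissible b n ε)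
    (a₀ : Parabolic b → A) :
    SatisfiesRecursion b n ε a₀ fun x => closedFormula b n ε a₀ x.1 x.2 := by
  intro R νR
  let _ : TopologicalSpace A := uvIdeal.adicModuleTopology A
  have hA : ‹TopologicalSpace A› = uvIdeal.adicModuleTopology A := rfl
  have := isTopologicalAddGroup_of_adic hA
  have := t2Space_of_adic hA
  have hT : ∀ P Q : Parabolic b, ∃ t : A, ∀ (h : P ⊆ Q) (h' : Q ⊆ R),
      HasSum (fun ν : {ν : TopType b P // pushType b (h.trans h') ν = νR} =>
        middleInd b P Q R (slope b P ν.1) •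
          uvPow ((mFun b n ε P ν - mFun b n ε R νR) / 2) • a₀ P) t := by
    intro P Q
    by_cases hPQ : P ⊆ Q ∧ Q ⊆ R
    · obtain ⟨t, ht⟩ := summable_of_adic hA (finite_middleInd hb hPQ.1 hPQ.2 νR (a₀ P))
      exact ⟨t, fun _ _ => ht⟩
    · exact ⟨0, fun h h' => absurd ⟨h, h'⟩ hPQ⟩
  choose t ht using hT
  refine ⟨fun Q => ∑ P ∈ Q.powerset, (-1 : ℤ) ^ Module.finrank ℝ (relSpace b P Q) • t P Q,
    fun Q hQ => ?_, ?_⟩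
  · refine hasTauSum_of_hasSum hA b hQ νR _ (HasSum.congr_fun (hasSum_sum fun P hP =>
      (hasSum_middleInd_fiberwise hA hb (Finset.mem_powerset.1 hP) hQ νR
        (ht P Q (Finset.mem_powerset.1 hP) hQ)).const_smul
          ((-1 : ℤ) ^ Module.finrank ℝ (relSpace b P Q))) fun νQ => ?_)
    simp only [closedFormula]
    rw [Finset.smul_sum, Finset.smul_sum]
    refine Finset.sum_congr rfl fun P _ => ?_
    rw [smul_comm (uvPow _) ((-1 : ℤ) ^ _), smul_comm (tau b Q R _) ((-1 : ℤ) ^ _)]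
    rfl
  · have hcomm : ∑ Q ∈ R.powerset, ∑ P ∈ Q.powerset,
        (-1 : ℤ) ^ Module.finrank ℝ (relSpace b P Q) • t P Q
        = ∑ P ∈ R.powerset, ∑ Q ∈ R.powerset with P ⊆ Q,
          (-1 : ℤ) ^ Module.finrank ℝ (relSpace b P Q) • t P Q := by
      refine Finset.sum_comm' fun Q P => ?_
      simp only [Finset.mem_powerset, Finset.mem_filter]
      exact ⟨fun hQ => ⟨⟨hQ.1, hQ.2⟩, hQ.2.trans hQ.1⟩, fun hQ => hQ.1⟩
    have hinner : ∀ P (hP : P ⊆ R), HasSum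
        (fun ν : {ν : TopType b P // pushType b hP ν = νR} =>
          ind (P = R) • uvPow ((mFun b n ε P ν - mFun b n ε R νR) / 2) • a₀ P)
        (∑ Q ∈ R.powerset with P ⊆ Q, (-1 : ℤ) ^ Module.finrank ℝ (relSpace b P Q) • t P Q) := by
      intro P hP
      have hQ : ∀ Q ∈ R.powerset.filter (P ⊆ ·), HasSum
          (fun ν : {ν : TopType b P // pushType b hP ν = νR} =>
            (-1 : ℤ) ^ Module.finrank ℝ (relSpace b P Q) • middleInd b P Q R (slope b P ν.1) •
              uvPow ((mFun b n ε P ν - mFun b n ε R νR) / 2) • a₀ P)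
          ((-1 : ℤ) ^ Module.finrank ℝ (relSpace b P Q) • t P Q) := by
        intro Q hQ
        rw [Finset.mem_filter, Finset.mem_powerset] at hQ
        exact (ht P Q hQ.2 hQ.1).const_smul _
      refine (hasSum_sum hQ).congr_fun fun ν => ?_
      rw [← sum_middleInd b P R (slope b P ν.1), Finset.sum_smul]
      exact Finset.sum_congr rfl fun Q _ => mul_smul _ _ _
    rw [hcomm, Finset.sum_eq_single_of_mem R (Finset.mem_powerset.2 subset_rfl)]
    · have huniq : ∀ ν : {ν : TopType b R // pushType b (subset_refl R) ν = νR}, ν.1 = νR :=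
        fun ν => (pushType_refl b _ ν.1).symm.trans ν.2
      let ν₀ : {ν : TopType b R // pushType b (subset_refl R) ν = νR} :=
        ⟨νR, pushType_refl b _ νR⟩
      have h1 := hasSum_single (f := fun ν : {ν : TopType b R // pushType b (subset_refl R) ν = νR}
        => ind (R = R) • uvPow ((mFun b n ε R ν - mFun b n ε R νR) / 2) • a₀ R) ν₀
        (fun ν hν => absurd (Subtype.ext (huniq ν)) hν)
      have h2 := h1.unique (hinner R subset_rfl)
      rw [← h2, ind_pos rfl, one_smul, sub_self, zero_div, uvPow_zero, one_smul]
    · intro P hP hne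
      refine HasSum.unique (hinner P (Finset.mem_powerset.1 hP)) ?_
      simp only [ind_neg hne, zero_smul]
      exact hasSum_zero

/-- The term `P = Q` of the recursion is `b₀(Q, ν_Q)` itself. -/
theorem HasTauSum.eq_of_refl [IsAdicComplete uvIdeal A] {Q : Parabolic b} {νQ : TopType b Q}
    {f : TopType b Q → A} {s : A} (hs : HasTauSum b (subset_refl Q) νQ f s) : s = f νQ := by
  let _ : TopologicalSpace A := uvIdeal.adicModuleTopology A
  have hA : ‹TopologicalSpace A› = uvIdeal.adicModuleTopology A := rfl
  have := t2Space_of_adic hA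
  have := chamberAtTop_neBot b (subset_refl Q)
  refine tendsto_nhds_unique hs (tendsto_const_nhds.congr fun T => ?_)
  let ν₀ : {ν : TopType b Q // pushType b (subset_refl Q) ν = νQ} := ⟨νQ, pushType_refl b _ νQ⟩
  rw [finsum_eq_single _ ν₀ fun ν hν =>
    absurd (Subtype.ext ((pushType_refl b _ ν.1).symm.trans ν.2)) hν]
  rw [Gam_eq_prod b (subset_refl Q)]
  have : relSimple b Q Q = ∅ := by
    simp [relSimple]
  rw [this, Finset.prod_empty, one_smul]

theorem SatisfiesRecursion.unique [IsAdicComplete uvIdeal A] {a₀ : Parabolic b → A}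
    {f g : TypePair b → A} (hf : SatisfiesRecursion b n ε a₀ f)
    (hg : SatisfiesRecursion b n ε a₀ g) : f = g := by
  let _ : TopologicalSpace A := uvIdeal.adicModuleTopology A
  have hA : ‹TopologicalSpace A› = uvIdeal.adicModuleTopology A := rfl
  have := t2Space_of_adic hA
  suffices ∀ (Q : Parabolic b) (νQ : TopType b Q), f ⟨Q, νQ⟩ = g ⟨Q, νQ⟩ from
    funext fun x => this x.1 x.2
  intro Q
  induction Q using Finset.strongInduction with
  | H Q ih =>
    intro νQ
    obtain ⟨s, hs, hsum⟩ := hf Q νQ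
    obtain ⟨s', hs', hsum'⟩ := hg Q νQ
    have hlt : ∀ P ∈ Q.powerset.erase Q, s P = s' P := by
      intro P hP
      rw [Finset.mem_erase, Finset.mem_powerset] at hP
      have := chamberAtTop_neBot b hP.2
      have h1 := hs P hP.2
      simp only [ih P (hP.2.ssubset_of_ne hP.1)] at h1
      exact tendsto_nhds_unique h1 (hs' P hP.2)
    have hmem : Q ∈ Q.powerset := Finset.mem_powerset.2 subset_rfl
    have heq : s Q = s' Q := by
      rw [hsum, ← Finset.add_sum_erase _ _ hmem, ← Finset.add_sum_erase _ _ hmem,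
        Finset.sum_congr rfl hlt] at hsum'
      exact add_right_cancel hsum'
    rw [(hs Q subset_rfl).eq_of_refl, (hs' Q subset_rfl).eq_of_refl] at heq
    simpa only [sub_self, zero_div, uvPow_zero, one_smul] using heq

end Inversion

end ReductiveInversion

open ReductiveInversion in
theorem mainTheorem3 {ι X Y : Type*} [Finite ι] [AddCommGroup X] [AddCommGroup Y]
    [Module.Finite ℤ X] [Module.Finite ℤ Y] (D : RootDatum ι X Y) [D.IsReduced] (b : D.Base)
    (n : Parabolic b → ℕ) (ε : Parabolic b → Module.Dual ℝ (A0 Y))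
    (hn : ∀ P Q : Parabolic b, P ⊆ Q → n Q ≤ n P)
    (hε : ∀ P : Parabolic b, ∀ x ∈ centerSpace b P, ε P x = 0)
    (hε' : ∀ P Q : Parabolic b, P ⊆ Q → ∀ x ∈ derivedSpace b P, (ε Q - ε P) x = 0)
    (hpos : ∀ P Q : Parabolic b, P ⊆ Q → ∀ α ∈ relSimple b P Q,
      ∃ k : ℤ, 0 < k ∧ (ε Q - ε P) (relCoroot b P α) = k)
    (heven : ∀ (P Q : Parabolic b) (h : P ⊆ Q) (ν : TopType b P),
      ∃ k : ℤ, mFun b n ε P ν - mFun b n ε Q (pushType b h ν) = 2 * k)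
    {A : Type*} [AddCommGroup A] [Module PS A] [IsAdicComplete uvIdeal A]
    (a₀ : Parabolic b → A) :
    (∃! b₀ : TypePair b → A, SatisfiesRecursion b n ε a₀ b₀) ∧
    ∀ b₀ : TypePair b → A, SatisfiesRecursion b n ε a₀ b₀ →
      ∀ (Q : Parabolic b) (νQ : TopType b Q), b₀ ⟨Q, νQ⟩ = closedFormula b n ε a₀ Q νQ := by
  have hsol := satisfiesRecursion_closedFormula ⟨hn, hε, hε', hpos, heven⟩ a₀
  refine ⟨⟨_, hsol, fun f hf => hf.unique hsol⟩, fun f hf Q νQ => ?_⟩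
  rw [hf.unique hsol]
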